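/- Let $M^{2n}$ be a smooth manifold with a smooth action $\theta$ of the torus $T^k$ whose fixed points are isolated. A $\theta$-equivariant stable complex structure on $M$ is an isomorphism of real vector bundles $c\colon \tau(M)\oplus\mathbb{R}^{2(l-n)}\to\xi$, where $l\ge n$ and $\xi$ is a complex vector bundle of rank $l$, such that $r(t)=c\circ(d\theta(t)\oplus I)\circ c^{-1}$ is complex linear on fibres for every $t\in T^k$. With $\mathbb{R}^{2(l-n)}$ given its canonical orientation and $\xi$ the orientation of its complex structure, $c$ defines an orientation of $\tau(M)$. At a fixed point $p$ the representation $r_p$ of $T^k$ on $\xi_p$ decomposes as $\xi_p=\mathbb{C}^{n}\oplus\mathbb{C}^{l-n}$, where $T^k$ acts trivially on $\mathbb{C}^{l-n}$ and without trivial summands on $\mathbb{C}^n$. The summand $\mathbb{C}^n$ is a direct sum of $n$ one-dimensional representations $e^{2\pi i\mathbf{x}}\mapsto e^{2\pi i\langle\Lambda_j(p),\mathbf{x}\rangle}$; the vectors $\Lambda_1(p),\dots,\Lambda_n(p)\in\mathbb{Z}^k$ are the weights of $c$ at $p$ (defined up to numbering). The sign $\mathrm{sign}(p)$ is $+1$ if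 the composition $\tau_p(M)\to\tau_p(M)\oplus\mathbb{R}^{2(l-n)}\xrightarrow{c}\xi_p=\mathbb{C}^n\oplus\mathbb{C}^{l-n}\to\mathbb{C}^n$ preserves orientation, and $-1$ otherwise. Let $c^1$ and $c^2$ be two $\theta$-equivariant stable complex structures on $M$ (possibly with different $l$ and $\xi$). 1. At every fixed point $p$ the weights $\Lambda^1_i(p)$ of $c^1$ and $\Lambda^2_i(p)$ of $c^2$ exist and, after a suitable renumbering, satisfy $\Lambda^2_i(p)=a_i(p)\Lambda^1_i(p)$ with $a_i(p)=\pm1$, $1\le i\le n$. 2. Suppose that $c^1$ and $c^2$ define the same orientation of $\tau(M)$, and put $\epsilon=1$, or that they define opposite orientations everywhere on $M$, and put $\epsilon=-1$; if $M$ is connected, one of these two cases always occurs. Then at every fixed point $p$, for any numberings of the weights and any $a_i(p)=\pm1$ with $\Lambda^2_i(p)=a_i(p)\Lambda^1_i(p)$ for all $i$, $$\mathrm{sign}(p)_2=\epsilon\cdot\prod_{i=1}^n a_i(p)\cdot\mathrm{sign}(p)_1 .$$ -/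

import Mathlib

open scoped Manifold ContDiff Topology
open Bundle

/-- The compact torus `T^k`, a product of `k` unit circles. -/
abbrev Torus (k : ℕ) : Type := Fin k → Circle

/-- The model with corners (modelled on `ℝ^k`) of the product manifold `T^k`. -/
noncomputable abbrev torusModel (k : ℕ) :=
  ModelWithCorners.pi (fun _ : Fin k => 𝓡 1)

/-- The character `t ↦ ∏ⱼ tⱼ ^ Λⱼ` of `T^k`, that is `e^{2πi x} ↦ e^{2πi ⟨Λ, x⟩}`. -/
noncomputable def torusChar {k : ℕ} (Λ : Fin k → ℤ) (t : Torus k) : ℂ :=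
  ((∏ j, t j ^ Λ j : Circle) : ℂ)

/-- The real basis `(e₁, i e₁, …, e_l, i e_l)` underlying a complex basis `(e₁, …, e_l)`. -/
noncomputable def realBasisOfComplex {l : ℕ} {V : Type*} [AddCommGroup V] [Module ℂ V]
    (e : Module.Basis (Fin l) ℂ V) : Module.Basis (Fin (2 * l)) ℝ V :=
  (Complex.basisOneI.smulTower' e).reindex
    (finProdFinEquiv.trans (finCongr (Nat.mul_comm l 2)))

/-- A family of `2l` vectors of an `l`-dimensional complex vector space is a real basis which is
positive for the canonical orientation of the complex vector space. -/
def IsComplexPositive {l : ℕ} {V : Type*} [AddCommGroup V] [Module ℂ V]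
    (w : Fin (2 * l) → V) : Prop :=
  ∃ e : Module.Basis (Fin l) ℂ V, 0 < (realBasisOfComplex e).det w

/-- A stable complex structure on a manifold `M` of dimension `2n`: an isomorphism of real vector
bundles `τ(M) ⊕ ℝ^{2m} ≅ ξ`, where `ξ` is a complex vector bundle of rank `l = n + m`. -/
structure StableComplexStructure (n m : ℕ) (M : Type*) [TopologicalSpace M]
    [ChartedSpace (EuclideanSpace ℝ (Fin (2 * n))) M] [IsManifold (𝓡 (2 * n)) ∞ M]
    (ξ : M → Type*) [TopologicalSpace (TotalSpace (EuclideanSpace ℂ (Fin (n + m))) ξ)]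
    [∀ x, AddCommGroup (ξ x)] [∀ x, Module ℂ (ξ x)] where
  /-- the isomorphism on fibres -/
  iso : ∀ x : M,
    (TangentSpace (𝓡 (2 * n)) x × EuclideanSpace ℝ (Fin (2 * m))) ≃ₗ[ℝ] ξ x
  continuous_iso : Continuous
    (fun v : TotalSpace (EuclideanSpace ℝ (Fin (2 * n)) × EuclideanSpace ℝ (Fin (2 * m)))
        ((TangentSpace (𝓡 (2 * n)) : M → Type _) ×ᵇ
          Bundle.Trivial M (EuclideanSpace ℝ (Fin (2 * m)))) =>
      (⟨v.1, iso v.1 v.2⟩ : TotalSpace (EuclideanSpace ℂ (Fin (n + m))) ξ))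
  continuous_iso_symm : Continuous
    (fun v : TotalSpace (EuclideanSpace ℂ (Fin (n + m))) ξ =>
      (⟨v.1, (iso v.1).symm v.2⟩ :
        TotalSpace (EuclideanSpace ℝ (Fin (2 * n)) × EuclideanSpace ℝ (Fin (2 * m)))
          ((TangentSpace (𝓡 (2 * n)) : M → Type _) ×ᵇ
            Bundle.Trivial M (EuclideanSpace ℝ (Fin (2 * m))))))

namespace StableComplexStructure

variable {n m k : ℕ} {M : Type*} [TopologicalSpace M]
  [ChartedSpace (EuclideanSpace ℝ (Fin (2 * n))) M] [IsManifold (𝓡 (2 * n)) ∞ M]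
  {ξ : M → Type*} [TopologicalSpace (TotalSpace (EuclideanSpace ℂ (Fin (n + m))) ξ)]
  [∀ x, AddCommGroup (ξ x)] [∀ x, Module ℂ (ξ x)]

/-- The map `dθ(t) ⊕ I` on the fibre of `τ(M) ⊕ ℝ^{2m}` over `x`. -/
noncomputable def tangentStab (n m : ℕ) {k : ℕ} {M : Type*} [TopologicalSpace M]
    [ChartedSpace (EuclideanSpace ℝ (Fin (2 * n))) M] [MulAction (Torus k) M]
    (t : Torus k) (x : M) :
    (TangentSpace (𝓡 (2 * n)) x × EuclideanSpace ℝ (Fin (2 * m))) →ₗ[ℝ]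
      (TangentSpace (𝓡 (2 * n)) (t • x) × EuclideanSpace ℝ (Fin (2 * m))) :=
  LinearMap.prodMap
    (mfderiv (𝓡 (2 * n)) (𝓡 (2 * n)) (fun y : M => t • y) x).toLinearMap LinearMap.id

/-- The real bundle transformation `r(t) = c ∘ (dθ(t) ⊕ I) ∘ c⁻¹` of `ξ`, on the fibre over `x`. -/
noncomputable def transport (c : StableComplexStructure n m M ξ) [MulAction (Torus k) M]
    (t : Torus k) (x : M) : ξ x →ₗ[ℝ] ξ (t • x) :=
  (c.iso (t • x)).toLinearMap ∘ₗ tangentStab n m t x ∘ₗ (c.iso x).symm.toLinearMap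

/-- A basis of the tangent space `τ_x(M)` is positive for the orientation of `τ(M)` defined by `c`:
followed by the standard basis of `ℝ^{2m}`, it is sent by `c` to a positive basis of `ξ_x`. -/
def IsPositiveBasis (c : StableComplexStructure n m M ξ) (x : M)
    (b : Module.Basis (Fin (2 * n)) ℝ (TangentSpace (𝓡 (2 * n)) x)) : Prop :=
  IsComplexPositive (l := n + m) (fun i : Fin (2 * (n + m)) =>
    Fin.append (fun j : Fin (2 * n) => c.iso x (b j, 0))
      (fun j : Fin (2 * m) => c.iso x (0, EuclideanSpace.single j 1))
      (finCongr (Nat.mul_add 2 n m) i))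

variable {m' : ℕ} {ξ' : M → Type*}
  [TopologicalSpace (TotalSpace (EuclideanSpace ℂ (Fin (n + m'))) ξ')]
  [∀ x, AddCommGroup (ξ' x)] [∀ x, Module ℂ (ξ' x)]

/-- Two stable complex structures define the same orientation of `τ(M)`. -/
def SameOrientation (c : StableComplexStructure n m M ξ) (c' : StableComplexStructure n m' M ξ') :
    Prop :=
  ∀ (x : M) (b : Module.Basis (Fin (2 * n)) ℝ (TangentSpace (𝓡 (2 * n)) x)),
    c'.IsPositiveBasis x b ↔ c.IsPositiveBasis x b

/-- Two stable complex structures define opposite orientations of `τ(M)`. -/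
def OppositeOrientation (c : StableComplexStructure n m M ξ)
    (c' : StableComplexStructure n m' M ξ') : Prop :=
  ∀ (x : M) (b : Module.Basis (Fin (2 * n)) ℝ (TangentSpace (𝓡 (2 * n)) x)),
    c'.IsPositiveBasis x b ↔ ¬ c.IsPositiveBasis x b

end StableComplexStructure

/-- A stable complex structure which is equivariant under a given action of `T^k` on `M`: every
`r(t)` is a complex transformation of `ξ`. -/
structure EquivariantStableComplexStructure (n m k : ℕ) (M : Type*) [TopologicalSpace M]
    [ChartedSpace (EuclideanSpace ℝ (Fin (2 * n))) M] [IsManifold (𝓡 (2 * n)) ∞ M]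
    [MulAction (Torus k) M]
    (ξ : M → Type*) [TopologicalSpace (TotalSpace (EuclideanSpace ℂ (Fin (n + m))) ξ)]
    [∀ x, AddCommGroup (ξ x)] [∀ x, Module ℂ (ξ x)]
    extends StableComplexStructure n m M ξ where
  transport_smul : ∀ (t : Torus k) (x : M) (z : ℂ) (v : ξ x),
    toStableComplexStructure.transport t x (z • v) =
      z • toStableComplexStructure.transport t x v

/-- The identification of the fibres over two equal points. -/
def fibreCast {M : Type*} {ξ : M → Type*} [∀ x, AddCommGroup (ξ x)] [∀ x, Module ℂ (ξ x)]
    {x y : M} (h : x = y) : ξ x ≃ₗ[ℂ] ξ y :=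
  h ▸ LinearEquiv.refl ℂ (ξ x)

namespace EquivariantStableComplexStructure

variable {n m k : ℕ} {M : Type*} [TopologicalSpace M]
  [ChartedSpace (EuclideanSpace ℝ (Fin (2 * n))) M] [IsManifold (𝓡 (2 * n)) ∞ M]
  [MulAction (Torus k) M]
  {ξ : M → Type*} [TopologicalSpace (TotalSpace (EuclideanSpace ℂ (Fin (n + m))) ξ)]
  [∀ x, AddCommGroup (ξ x)] [∀ x, Module ℂ (ξ x)]

/-- The representation `r_p` of `T^k` on the fibre `ξ_p` over a fixed point `p`. -/
noncomputable def rep (c : EquivariantStableComplexStructure n m k M ξ) {p : M}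
    (hp : ∀ t : Torus k, t • p = p) (t : Torus k) : ξ p →ₗ[ℂ] ξ p :=
  (fibreCast (ξ := ξ) (hp t)).toLinearMap ∘ₗ
    { toFun := c.transport t p
      map_add' := map_add _
      map_smul' := c.transport_smul t p }

/-- The trivial summand `ℂ^{l-n}` of `r_p`: the vectors fixed by the torus. -/
noncomputable def trivialPart (c : EquivariantStableComplexStructure n m k M ξ) {p : M}
    (hp : ∀ t : Torus k, t • p = p) : Submodule ℂ (ξ p) :=
  ⨅ t : Torus k, LinearMap.ker (c.rep hp t - LinearMap.id)

/-- The summand `ℂ^n` of `r_p` without trivial summands, spanned by the vectors `r_p(t) v - v`. It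
is the unique invariant complement of `trivialPart`. -/
noncomputable def nontrivialPart (c : EquivariantStableComplexStructure n m k M ξ) {p : M}
    (hp : ∀ t : Torus k, t • p = p) : Submodule ℂ (ξ p) :=
  ⨆ t : Torus k, LinearMap.range (c.rep hp t - LinearMap.id)


/-- The differential of `θ(t)` at a fixed point, as an endomorphism of the model space. -/
noncomputable def tangentRep (n : ℕ) {k : ℕ} {M : Type*} [TopologicalSpace M]
    [ChartedSpace (EuclideanSpace ℝ (Fin (2 * n))) M] [MulAction (Torus k) M]
    (p : M) (t : Torus k) : EuclideanSpace ℝ (Fin (2 * n)) →L[ℝ] EuclideanSpace ℝ (Fin (2 * n)) :=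
  mfderiv (𝓡 (2 * n)) (𝓡 (2 * n)) (fun y : M => t • y) p

theorem rep_iso (c : EquivariantStableComplexStructure n m k M ξ) {p : M}
    (hp : ∀ t : Torus k, t • p = p) (t : Torus k)
    (w : EuclideanSpace ℝ (Fin (2 * n)) × EuclideanSpace ℝ (Fin (2 * m))) :
    c.rep hp t (c.iso p w) = c.iso p (tangentRep n p t w.1, w.2) := by
  have key : ∀ (x y : M) (h : x = y)
      (w : EuclideanSpace ℝ (Fin (2 * n)) × EuclideanSpace ℝ (Fin (2 * m))),
      fibreCast (ξ := ξ) h (c.iso x w) = c.iso y w := by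
    intro x y h w
    subst h
    rfl
  have h2 : c.transport t p (c.iso p w) = c.iso (t • p) (tangentRep n p t w.1, w.2) := by
    simp only [StableComplexStructure.transport, LinearMap.comp_apply, LinearEquiv.coe_coe]
    erw [LinearEquiv.symm_apply_apply]
    rfl
  change fibreCast (ξ := ξ) (hp t) (c.transport t p (c.iso p w)) = _
  rw [h2]
  exact key _ _ (hp t) _

/-- The componentwise exponential map `ℝ^k → T^k` is smooth. -/
theorem contMDiff_torusExp (k : ℕ) :
    ContMDiff 𝓘(ℝ, Fin k → ℝ) (torusModel k) ∞
      (fun (x : Fin k → ℝ) (i : Fin k) => Circle.exp (x i)) := by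
  have hi : ∀ i : Fin k, ContMDiff 𝓘(ℝ, Fin k → ℝ) (𝓡 1) ∞
      (fun x : Fin k → ℝ => Circle.exp (x i)) := fun i =>
    contMDiff_circleExp.comp
      ((ContinuousLinearMap.proj (R := ℝ) (φ := fun _ : Fin k => ℝ) i).contDiff.contMDiff)
  intro x
  rw [contMDiffAt_iff]
  refine ⟨(continuous_pi fun i => (hi i).continuous).continuousAt, ?_⟩
  rw [contDiffWithinAt_pi]
  intro i
  exact (contMDiffAt_iff.1 (hi i x)).2

set_option linter.unusedSectionVars false

variable [ContMDiffSMul (torusModel k) (𝓡 (2 * n)) ∞ (Torus k) M]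

theorem contMDiff_torus_smul (t : Torus k) :
    ContMDiff (𝓡 (2 * n)) (𝓡 (2 * n)) ∞ (fun y : M => t • y) :=
  (contMDiff_smul (I := torusModel k) (I' := 𝓡 (2 * n)) (n := ∞) (G := Torus k) (M := M)).comp
    (contMDiff_const.prodMk contMDiff_id)

theorem tangentRep_mul {p : M} (hp : ∀ t : Torus k, t • p = p) (s t : Torus k)
    (w : EuclideanSpace ℝ (Fin (2 * n))) :
    tangentRep n p (s * t) w = tangentRep n p s (tangentRep n p t w) := by
  have hd : ∀ (t : Torus k) (q : M),
      MDifferentiableAt (𝓡 (2 * n)) (𝓡 (2 * n)) (fun y : M => t • y) q := fun t q =>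
    (contMDiff_torus_smul t).contMDiffAt.mdifferentiableAt (by simp)
  have h1 : (fun y : M => (s * t) • y) = (fun y : M => s • y) ∘ (fun y : M => t • y) := by
    funext y
    simp [mul_smul]
  have h2 : ∀ q : M, q = p → ∀ w : EuclideanSpace ℝ (Fin (2 * n)),
      tangentRep n q s w = tangentRep n p s w := by
    rintro q rfl w
    rfl
  have h3 := mfderiv_comp p (hd s (t • p)) (hd t p)
  rw [← h1] at h3
  have h4 : tangentRep n p (s * t) w = tangentRep n (t • p) s (tangentRep n p t w) :=
    DFunLike.congr_fun h3 w
  rw [h4, h2 _ (hp t)]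

theorem tangentRep_one (p : M) (w : EuclideanSpace ℝ (Fin (2 * n))) :
    tangentRep n p (1 : Torus k) w = w := by
  have h1 : (fun y : M => (1 : Torus k) • y) = id := by
    funext y
    simp
  unfold tangentRep
  rw [h1, mfderiv_id]
  rfl

theorem continuous_tangentRep {p : M} (hp : ∀ t : Torus k, t • p = p) :
    Continuous (fun t : Torus k => tangentRep n p t) := by
  have hq : IsOpenQuotientMap (fun (x : Fin k → ℝ) (i : Fin k) => Circle.exp (x i)) := by
    refine ⟨?_, ?_, ?_⟩
    · intro t
      exact ⟨fun i => (t i : ℂ).arg, funext fun i => Circle.exp_arg (t i)⟩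
    · exact continuous_pi fun i => Circle.exp.continuous.comp (continuous_apply i)
    · refine IsOpenMap.piMap (f := fun (_ : Fin k) => ⇑Circle.exp)
        (fun i => isLocalHomeomorph_circleExp.isOpenMap) ?_
      simp
  rw [hq.isQuotientMap.continuous_iff]
  rw [continuous_iff_continuousAt]
  intro x₀
  let f : (Fin k → ℝ) → M → M := fun x y => (fun i => Circle.exp (x i) : Torus k) • y
  have hf : ContMDiff (𝓘(ℝ, Fin k → ℝ).prod (𝓡 (2 * n))) (𝓡 (2 * n)) ∞ (Function.uncurry f) :=
    (contMDiff_smul (I := torusModel k) (I' := 𝓡 (2 * n)) (n := ∞) (G := Torus k) (M := M)).comp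
      (((contMDiff_torusExp k).comp contMDiff_fst).prodMk contMDiff_snd)
  have h : ContinuousAt (inTangentCoordinates (𝓡 (2 * n)) (𝓡 (2 * n)) (fun _ => p)
      (fun x => f x p) (fun x => tangentRep n p (fun i => Circle.exp (x i))) x₀) x₀ :=
    (ContMDiffAt.mfderiv (m := 0) (n := ∞) (x₀ := x₀) f (fun _ => p)
      hf.contMDiffAt contMDiffAt_const (by simp)).continuousAt
  refine h.congr (Filter.Eventually.of_forall fun x => ?_)
  have hfp : ∀ x, f x p = p := fun x => hp _
  have hx : f x p ∈ (chartAt (EuclideanSpace ℝ (Fin (2 * n))) (f x₀ p)).source := by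
    rw [hfp, hfp]
    exact mem_chart_source _ _
  refine (inTangentCoordinates_eq (fun _ => p) (fun x => f x p) _ (mem_chart_source _ _)
    hx).trans ?_
  ext1 w
  simp only [ContinuousLinearMap.comp_apply]
  rw [hfp, hfp]
  rw [VectorBundleCore.coordChange_self _ _ _ (mem_chart_source _ _)]
  rw [VectorBundleCore.coordChange_self _ _ _ (mem_chart_source _ _)]
  rfl

theorem isCompl_nontrivialPart_trivialPart (c : EquivariantStableComplexStructure n m k M ξ) {p : M}
    (hp : ∀ t : Torus k, t • p = p) : IsCompl (c.nontrivialPart hp) (c.trivialPart hp) := by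
  let W := EuclideanSpace ℝ (Fin (2 * n)) × EuclideanSpace ℝ (Fin (2 * m))
  let : MeasurableSpace (Torus k) := borel _
  have : BorelSpace (Torus k) := ⟨rfl⟩
  let μ : MeasureTheory.Measure (Torus k) := MeasureTheory.Measure.haarMeasure ⊤
  have : MeasureTheory.IsProbabilityMeasure μ :=
    ⟨MeasureTheory.Measure.haarMeasure_self⟩
  let R : Torus k → W → W := fun t w => (tangentRep n p t w.1, w.2)
  let φ : W ≃ₗ[ℝ] ξ p := c.iso p
  have hR : ∀ t w, c.rep hp t (φ w) = φ (R t w) := fun t w => rep_iso c hp t w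
  have hRR : ∀ s t w, R (s * t) w = R s (R t w) := fun s t w =>
    Prod.ext (tangentRep_mul hp s t w.1) rfl
  have hcont : ∀ w, Continuous (fun t => R t w) := fun w =>
    ((continuous_tangentRep hp).clm_apply continuous_const).prodMk continuous_const
  have hint : ∀ w, MeasureTheory.Integrable (fun t => R t w) μ := fun w =>
    (hcont w).integrable_of_hasCompactSupport (HasCompactSupport.of_compactSpace _)
  let RL : Torus k → W →L[ℝ] W := fun t =>
    (tangentRep n p t).prodMap (ContinuousLinearMap.id ℝ _)
  have hRL : ∀ t w, RL t w = R t w := fun t w => rfl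
  let P : W → W := fun w => ∫ t, R t w ∂μ
  have hPadd : ∀ v w, P (v + w) = P v + P w := by
    intro v w
    simp only [P, ← hRL, map_add]
    exact MeasureTheory.integral_add (hint v) (hint w)
  have hP1 : ∀ s w, R s (P w) = P w := by
    intro s w
    have h1 : RL s (P w) = ∫ t, RL s (R t w) ∂μ := ((RL s).integral_comp_comm (hint w)).symm
    rw [← hRL, h1]
    simp only [hRL, ← hRR]
    exact MeasureTheory.integral_mul_left_eq_self (fun t => R t w) s
  have hP2 : ∀ s w, P (R s w) = P w := by
    intro s w
    simp only [P, ← hRR]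
    exact MeasureTheory.integral_mul_right_eq_self (fun t => R t w) s
  have hsurj : ∀ v : ξ p, ∃ w : W, φ w = v := fun v => (φ).surjective v
  have hinj : ∀ v w : W, φ v = φ w → v = w := fun v w h => (φ).injective h
  have hmem : ∀ w : W, φ w ∈ c.trivialPart hp ↔ ∀ t, R t w = w := by
    intro w
    simp only [trivialPart, Submodule.mem_iInf, LinearMap.mem_ker, LinearMap.sub_apply,
      LinearMap.id_apply, sub_eq_zero, hR]
    exact forall_congr' fun t => ⟨fun h => hinj _ _ h, fun h => by rw [h]⟩
  have hN0 : ∀ v ∈ c.nontrivialPart hp, ∀ w : W, φ w = v → P w = 0 := by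
    intro v hv
    induction hv using Submodule.iSup_induction' with
    | mem t v hv =>
      obtain ⟨u, rfl⟩ := hv
      obtain ⟨u, rfl⟩ := hsurj u
      intro w hw
      have : w + u = R t u := by
        apply hinj
        rw [← hR]
        rw [map_add, hw]
        simp
      have h2 := hP2 t u
      rw [← this, hPadd] at h2
      simpa using h2
    | zero =>
      intro w hw
      have : w = 0 := by
        apply hinj
        rw [hw]
        exact (map_zero (φ)).symm
      subst this
      simpa using hPadd 0 0
    | add v₁ v₂ _ _ h₁ h₂ =>
      intro w hw
      obtain ⟨w₁, rfl⟩ := hsurj v₁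
      obtain ⟨w₂, rfl⟩ := hsurj v₂
      have : w = w₁ + w₂ := by
        apply hinj
        rw [hw]
        exact (map_add (φ) w₁ w₂).symm
      rw [this, hPadd, h₁ _ rfl, h₂ _ rfl, add_zero]
  constructor
  · rw [Submodule.disjoint_def]
    intro v hv hv'
    obtain ⟨w, rfl⟩ := hsurj v
    have h1 := (hmem w).1 hv'
    have h2 := hN0 _ hv w rfl
    have h3 : P w = w := by simp [P, h1]
    rw [← h3, h2]
    exact map_zero (φ)
  · rw [codisjoint_iff_le_sup]
    intro v _
    obtain ⟨w, rfl⟩ := hsurj v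
    let S : Submodule ℝ W :=
      ((c.nontrivialPart hp).restrictScalars ℝ).comap (φ).toLinearMap
    have hS : P w - w ∈ S := by
      have h1 : P w - w = ∫ t, (R t w - w) ∂μ := by
        rw [MeasureTheory.integral_sub (hint w) (MeasureTheory.integrable_const w)]
        simp [P]
      rw [h1]
      refine S.convex.integral_mem S.closed_of_finiteDimensional
        (Filter.Eventually.of_forall fun t => ?_)
        ((hint w).sub (MeasureTheory.integrable_const w))
      change φ (R t w - w) ∈ c.nontrivialPart hp
      refine Submodule.mem_iSup_of_mem t ⟨φ w, ?_⟩
      rw [LinearMap.sub_apply, hR]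
      exact (map_sub (φ) (R t w) w).symm
    have hS' : φ (P w - w) ∈ c.nontrivialPart hp := hS
    have hT : φ (P w) ∈ c.trivialPart hp := (hmem _).2 fun t => hP1 t w
    have h2 : φ w = - φ (P w - w) + φ (P w) := by
      rw [show φ (P w - w) = φ (P w) - φ w from map_sub (φ) (P w) w]
      abel
    rw [h2]
    exact Submodule.add_mem_sup (neg_mem hS') hT

/-- `Λ = (Λ₁, …, Λₙ)` is the weight vector of `c` at the fixed point `p`, in some numbering: the
summand `ℂ^n` of `ξ_p` is the direct sum of `n` lines on which `T^k` acts by the characters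
`Λ₁, …, Λₙ`. -/
def IsWeightVector (c : EquivariantStableComplexStructure n m k M ξ) {p : M}
    (hp : ∀ t : Torus k, t • p = p) (Λ : Fin n → Fin k → ℤ) : Prop :=
  ∃ b : Module.Basis (Fin n) ℂ (c.nontrivialPart hp),
    ∀ (i : Fin n) (t : Torus k), c.rep hp t (b i) = torusChar (Λ i) t • (b i : ξ p)

open Classical in
/-- The sign of `c` at the fixed point `p`: it is `+1` if the composition
`τ_p → τ_p ⊕ ℝ^{2m} → ξ_p = ℂ^n ⊕ ℂ^{l-n} → ℂ^n` preserves orientation, and `-1` otherwise. -/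
noncomputable def sign (c : EquivariantStableComplexStructure n m k M ξ) {p : M}
    (hp : ∀ t : Torus k, t • p = p) : ℤˣ :=
  if ∀ b : Module.Basis (Fin (2 * n)) ℝ (TangentSpace (𝓡 (2 * n)) p),
    c.IsPositiveBasis p b ↔
      IsComplexPositive (fun i : Fin (2 * n) =>
        (c.nontrivialPart hp).projectionOnto (c.trivialPart hp)
          (c.isCompl_nontrivialPart_trivialPart hp) (c.iso p (b i, 0)))
  then 1 else -1

end EquivariantStableComplexStructure

/-!
Everything happens in the tangent representation `ρ` of the torus on `τ_p(M)` at a fixed point `p`,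
which does not depend on the stable complex structure.

Averaging a chart at `p` over the compact torus, twisted by `ρ`, gives an equivariant map to
`τ_p(M)` with derivative the identity, hence a local linearisation of the action
(`hasStrictFDerivAt_linearisation`). A nonzero vector fixed by `ρ` would therefore give fixed points
accumulating at `p`, so if `p` is isolated then `ρ` has no fixed vectors
(`eq_zero_of_tangentRep_fixed`). It follows that an equivariant stable complex structure identifies
`τ_p(M)` with the summand `ℂ^n` of `ξ_p` (`tangentIso`), and `ℝ^{2(l-n)}` with the trivial summand.
The weights exist because the Fourier coefficients of the orbits of a continuous representation are
weight vectors and span (`span_weightVectors_eq_top`).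

Two structures thus give two sets of coordinates `τ_p(M) ≅ ℂ^n`, both diagonalising `ρ`. Conjugating
some of the coordinates, one may take all weights to be positive in the lexicographic order; the
orientation changes by the product of the signs used. Then no weight of one structure is the
negative of a weight of the other, so the transition map between the coordinates has no antilinear
part and its entries vanish unless the weights agree (`intertwiner_line`). Being complex linear, it
has a positive real determinant, and a nonzero term of the Leibniz formula for its complex
determinant is a bijection of the weights (`intertwiner_perm_and_det_pos`). Undoing the conjugations
gives the relation between the weights, and shows that the orientations of `ℂ^n` pulled back to
`τ_p(M)` differ by `∏ a_i`. As the orientations defined by the stable complex structures differ by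
`ε`, the signs differ by the product of the two.

On a connected manifold the comparison of the two orientations is constant, because in local
trivialisations each orientation is the sign of a nonvanishing continuous determinant
(`StableComplexStructure.eventually_isPositiveBasis_iff`).
-/

/-! ### Characters of the torus -/

theorem torusChar_zero {k : ℕ} (t : Torus k) : torusChar 0 t = 1 := by
  simp [torusChar]

theorem torusChar_neg {k : ℕ} (Λ : Fin k → ℤ) (t : Torus k) :
    torusChar (-Λ) t = (starRingEnd ℂ) (torusChar Λ t) := by
  simp [torusChar, ← Circle.coe_inv_eq_conj, Finset.prod_inv_distrib]

/-- The surjection from the additive torus `(ℝ/ℤ)^k` onto `T^k`. -/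
noncomputable def torusOfAdd {k : ℕ} (x : UnitAddTorus (Fin k)) : Torus k :=
  fun i => (x i).toCircle

theorem continuous_torusOfAdd {k : ℕ} : Continuous (torusOfAdd (k := k)) :=
  continuous_pi fun i => AddCircle.continuous_toCircle.comp (continuous_apply i)

theorem torusOfAdd_surjective {k : ℕ} : Function.Surjective (torusOfAdd (k := k)) := fun t =>
  ⟨fun i => (AddCircle.homeomorphCircle one_ne_zero).symm (t i),
    funext fun i => by
      rw [torusOfAdd, ← AddCircle.homeomorphCircle_apply one_ne_zero,
        Homeomorph.apply_symm_apply]⟩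

theorem torusOfAdd_add {k : ℕ} (x y : UnitAddTorus (Fin k)) :
    torusOfAdd (x + y) = torusOfAdd x * torusOfAdd y :=
  funext fun i => AddCircle.toCircle_add (x i) (y i)

theorem torusOfAdd_zero {k : ℕ} : torusOfAdd (0 : UnitAddTorus (Fin k)) = 1 :=
  funext fun _ => AddCircle.toCircle_zero

theorem torusChar_torusOfAdd {k : ℕ} (Λ : Fin k → ℤ) (x : UnitAddTorus (Fin k)) :
    torusChar Λ (torusOfAdd x) = UnitAddTorus.mFourier Λ x := by
  simp only [torusChar, torusOfAdd, UnitAddTorus.mFourier, ContinuousMap.coe_mk, fourier_apply,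
    AddCircle.toCircle_zsmul]
  exact map_prod Circle.coeHom _ _

theorem torusChar_injective {k : ℕ} :
    Function.Injective (torusChar : (Fin k → ℤ) → Torus k → ℂ) := by
  intro Λ Λ' h
  refine (UnitAddTorus.orthonormal_mFourier (d := Fin k)).linearIndependent.injective ?_
  have : UnitAddTorus.mFourier Λ = UnitAddTorus.mFourier Λ' := by
    ext x
    rw [← torusChar_torusOfAdd, ← torusChar_torusOfAdd, h]
  simp only [UnitAddTorus.mFourierLp, this]

/-- One of the two vectors `±Λ` is positive in the lexicographic order if `Λ ≠ 0`. -/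
theorem exists_sign_smul_lex_pos {k : ℕ} {Λ : Fin k → ℤ} (h : Λ ≠ 0) :
    ∃ s : ℤˣ, 0 < toLex ((s : ℤ) • Λ) := by
  rcases lt_trichotomy 0 (toLex Λ) with h' | h' | h'
  · exact ⟨1, by rw [Units.val_one, one_smul]; exact h'⟩
  · exact absurd (toLex_inj.1 h').symm h
  · refine ⟨-1, ?_⟩
    have : toLex (((-1 : ℤˣ) : ℤ) • Λ) = - toLex Λ := by simp
    rw [this]
    exact neg_pos.2 h'

/-- Either the identity or complex conjugation, according to a sign. -/
noncomputable def signConj (s : ℤˣ) : ℂ ≃ₗ[ℝ] ℂ :=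
  if s = 1 then LinearEquiv.refl ℝ ℂ else Complex.conjAe.toLinearEquiv

theorem signConj_torusChar_mul {k : ℕ} (s : ℤˣ) (Λ : Fin k → ℤ) (t : Torus k) (z : ℂ) :
    signConj s (torusChar Λ t * z) = torusChar ((s : ℤ) • Λ) t * signConj s z := by
  rcases Int.units_eq_one_or s with rfl | rfl
  · simp [signConj]
  · simp [signConj, torusChar_neg]

theorem det_signConj (s : ℤˣ) : LinearMap.det (signConj s : ℂ →ₗ[ℝ] ℂ) = ((s : ℤ) : ℝ) := by
  rcases Int.units_eq_one_or s with rfl | rfl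
  · simp [signConj]
  · have : ((-1 : ℤˣ) = 1) = False := by simp
    simp only [signConj, this, if_false]
    rw [Complex.det_conjAe]
    simp

theorem Complex.exists_eq_mul_add_mul_conj (f : ℂ →ₗ[ℝ] ℂ) :
    ∃ a b : ℂ, ∀ z, f z = a * z + b * (starRingEnd ℂ) z := by
  refine ⟨(f 1 - Complex.I * f Complex.I) / 2, (f 1 + Complex.I * f Complex.I) / 2, fun z => ?_⟩
  have : f z = (z.re : ℂ) * f 1 + z.im * f Complex.I := by
    conv_lhs => rw [show z = z.re • (1 : ℂ) + z.im • Complex.I by simp [Complex.re_add_im]]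
    rw [map_add, map_smul, map_smul]
    simp
  rw [this]
  apply Complex.ext <;> simp <;> ring

/-- A real-linear map between two lines of lexicographically positive weights which intertwines the
torus actions is complex linear, as its antilinear part would make one weight the negative of the
other; it vanishes unless the weights agree. -/
theorem intertwiner_line {k : ℕ} {Λ Λ' : Fin k → ℤ} (hΛ : 0 < toLex Λ) (hΛ' : 0 < toLex Λ')
    (f : ℂ →ₗ[ℝ] ℂ) (hf : ∀ t z, f (torusChar Λ t * z) = torusChar Λ' t * f z) :
    (f 1 ≠ 0 → Λ' = Λ) ∧ ∀ z, f z = f 1 * z := by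
  obtain ⟨a, b, hab⟩ := Complex.exists_eq_mul_add_mul_conj f
  -- The values at `1` and `I` separate the linear coefficient `a` from the antilinear one `b`.
  have h1 := fun t => hf t 1
  have h2 := fun t => hf t Complex.I
  simp only [hab, mul_one, map_mul, Complex.conj_I, map_one] at h1 h2
  have ha : ∀ t, a * torusChar Λ t = a * torusChar Λ' t := by
    intro t
    linear_combination (h1 t - Complex.I * h2 t) / 2 +
      (a * torusChar Λ t - b * (starRingEnd ℂ) (torusChar Λ t) - a * torusChar Λ' t
        + b * torusChar Λ' t) / 2 * Complex.I_sq
  have hb : ∀ t, b * torusChar (-Λ) t = b * torusChar Λ' t := by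
    intro t
    rw [torusChar_neg]
    linear_combination h1 t - ha t
  have hb0 : b = 0 := by
    by_contra hb0
    have h : -Λ = Λ' := torusChar_injective (funext fun t => mul_left_cancel₀ hb0 (hb t))
    rw [← h] at hΛ'
    exact lt_asymm hΛ (neg_pos.1 hΛ')
  subst hb0
  refine ⟨fun hne => ?_, fun z => by simp [hab]⟩
  have ha0 : a ≠ 0 := by
    rintro rfl
    simp [hab] at hne
  exact (torusChar_injective (funext fun t => mul_left_cancel₀ ha0 (ha t))).symm

/-! ### Orientations of complex vector spaces -/

section Orientation

variable {l : ℕ} {V V' : Type*} [AddCommGroup V] [Module ℂ V] [AddCommGroup V'] [Module ℂ V']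

theorem LinearEquiv.det_restrictScalars_complex_pos [FiniteDimensional ℂ V] (f : V ≃ₗ[ℂ] V) :
    0 < LinearMap.det ((f : V →ₗ[ℂ] V).restrictScalars ℝ) := by
  rw [LinearMap.det_restrictScalars, Algebra.norm_complex_eq]
  exact Complex.normSq_pos.2 f.isUnit_det'.ne_zero

theorem realBasisOfComplex_map (e : Module.Basis (Fin l) ℂ V) (f : V ≃ₗ[ℂ] V') :
    realBasisOfComplex (e.map f) = (realBasisOfComplex e).map (f.restrictScalars ℝ) := by
  ext i
  simp [realBasisOfComplex, Module.Basis.smulTower'_apply]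

theorem det_realBasisOfComplex_pos (e e' : Module.Basis (Fin l) ℂ V) :
    0 < (realBasisOfComplex e).det (realBasisOfComplex e') := by
  have : FiniteDimensional ℂ V := e.finiteDimensional_of_finite
  let f : V ≃ₗ[ℂ] V := e.equiv e' (Equiv.refl _)
  have h : e' = e.map f := by
    ext i
    simp [f]
  have h2 : ⇑(realBasisOfComplex e') =
      ((f : V →ₗ[ℂ] V).restrictScalars ℝ) ∘ realBasisOfComplex e := by
    rw [h, realBasisOfComplex_map]
    rfl
  rw [h2, Module.Basis.det_comp, Module.Basis.det_self, mul_one]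
  exact f.det_restrictScalars_complex_pos

/-- The canonical orientation of a complex vector space may be computed in any complex basis. -/
theorem isComplexPositive_iff (e : Module.Basis (Fin l) ℂ V) (w : Fin (2 * l) → V) :
    IsComplexPositive w ↔ 0 < (realBasisOfComplex e).det w := by
  refine ⟨?_, fun h => ⟨e, h⟩⟩
  rintro ⟨e', h⟩
  rw [AlternatingMap.eq_smul_basis_det (realBasisOfComplex e') (realBasisOfComplex e).det]
  exact mul_pos (det_realBasisOfComplex_pos e e') h

theorem isComplexPositive_map_iff [FiniteDimensional ℂ V] (hV : Module.finrank ℂ V = l)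
    (f : V ≃ₗ[ℂ] V') (w : Fin (2 * l) → V) :
    IsComplexPositive (fun i => f (w i)) ↔ IsComplexPositive w := by
  let e := Module.finBasisOfFinrankEq ℂ V hV
  rw [isComplexPositive_iff (e.map f), isComplexPositive_iff e, realBasisOfComplex_map,
    Module.Basis.det_map]
  refine Eq.to_iff (congrArg (fun v => 0 < (realBasisOfComplex e).det v) (funext fun i => ?_))
  exact f.symm_apply_apply (w i)

end Orientation

/-- The real basis of `ℂ^n` underlying the standard complex basis. -/
noncomputable def complexStdRealBasis (n : ℕ) : Module.Basis (Fin (2 * n)) ℝ (Fin n → ℂ) :=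
  realBasisOfComplex (Pi.basisFun ℂ (Fin n))

/-! ### Comparison of two complex structures on a real representation -/

section Compare

variable {n k : ℕ}

/-- A real-linear isomorphism intertwining two sums of lines of lexicographically positive weights
is complex linear. A nonvanishing term of the Leibniz formula for its determinant matches the
weights, and its real determinant is positive. -/
theorem intertwiner_perm_and_det_pos {Λ Λ' : Fin n → Fin k → ℤ} (hΛ : ∀ i, 0 < toLex (Λ i))
    (hΛ' : ∀ i, 0 < toLex (Λ' i)) (Ψ : (Fin n → ℂ) ≃ₗ[ℝ] (Fin n → ℂ))
    (h : ∀ t z i, Ψ (fun j => torusChar (Λ j) t * z j) i = torusChar (Λ' i) t * Ψ z i) :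
    (∃ σ : Equiv.Perm (Fin n), ∀ i, Λ' (σ i) = Λ i) ∧
      0 < LinearMap.det (Ψ : (Fin n → ℂ) →ₗ[ℝ] (Fin n → ℂ)) := by
  let f : Fin n → Fin n → ℂ →ₗ[ℝ] ℂ := fun i j =>
    LinearMap.proj i ∘ₗ (Ψ : (Fin n → ℂ) →ₗ[ℝ] (Fin n → ℂ)) ∘ₗ
      LinearMap.single ℝ (fun _ : Fin n => ℂ) j
  have hf : ∀ i j z, f i j z = Ψ (Pi.single j z) i := fun i j z => rfl
  have hline : ∀ i j, (f i j 1 ≠ 0 → Λ' i = Λ j) ∧ ∀ z, f i j z = f i j 1 * z := by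
    intro i j
    refine intertwiner_line (hΛ j) (hΛ' i) (f i j) fun t z => ?_
    rw [hf, hf, ← h]
    refine congrFun (congrArg Ψ (funext fun j' => ?_)) i
    by_cases hj : j' = j
    · subst hj
      simp
    · simp [hj]
  have hsum : ∀ z i, Ψ z i = ∑ j, f i j (z j) := by
    intro z i
    conv_lhs => rw [← Finset.univ_sum_single z]
    simp [hf]
  have hsmul : ∀ (c : ℂ) z, Ψ (c • z) = c • Ψ z := by
    intro c z
    funext i
    rw [Pi.smul_apply, hsum, hsum, Finset.smul_sum]
    refine Finset.sum_congr rfl fun j _ => ?_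
    rw [(hline i j).2, (hline i j).2 (z j), Pi.smul_apply, smul_eq_mul, smul_eq_mul]
    ring
  let Ψc : (Fin n → ℂ) ≃ₗ[ℂ] (Fin n → ℂ) :=
    { Ψ with map_smul' := hsmul }
  refine ⟨?_, Ψc.det_restrictScalars_complex_pos⟩
  have hdet : (LinearMap.toMatrix' (Ψc : (Fin n → ℂ) →ₗ[ℂ] (Fin n → ℂ))).det ≠ 0 := by
    rw [LinearMap.det_toMatrix']
    exact Ψc.isUnit_det'.ne_zero
  rw [Matrix.det_apply] at hdet
  obtain ⟨σ, -, hσ⟩ := Finset.exists_ne_zero_of_sum_ne_zero hdet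
  refine ⟨σ, fun i => (hline (σ i) i).1 ?_⟩
  intro h0
  refine hσ ?_
  rw [Finset.prod_eq_zero (Finset.mem_univ i), smul_zero]
  rw [LinearMap.toMatrix'_apply]
  exact h0

variable {E : Type*} [AddCommGroup E] [Module ℝ E]

/-- Conjugating coordinates of a complex structure on `E` according to signs. -/
theorem exists_conj_coordinates {ρ : Torus k → E → E} {Λ : Fin n → Fin k → ℤ}
    (Φ : E ≃ₗ[ℝ] (Fin n → ℂ)) (h : ∀ t w i, Φ (ρ t w) i = torusChar (Λ i) t * Φ w i)
    (s : Fin n → ℤˣ) :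
    ∃ Φ' : E ≃ₗ[ℝ] (Fin n → ℂ),
      (∀ t w i, Φ' (ρ t w) i = torusChar ((s i : ℤ) • Λ i) t * Φ' w i) ∧
      ∀ v : Fin (2 * n) → E, (complexStdRealBasis n).det (Φ' ∘ v) =
        ((∏ i, s i : ℤˣ) : ℤ) * (complexStdRealBasis n).det (Φ ∘ v) := by
  let S : (Fin n → ℂ) ≃ₗ[ℝ] (Fin n → ℂ) := LinearEquiv.piCongrRight fun i => signConj (s i)
  refine ⟨Φ.trans S, fun t w i => ?_, fun v => ?_⟩
  · change signConj (s i) (Φ (ρ t w) i) = _ * signConj (s i) (Φ w i)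
    rw [h, signConj_torusChar_mul]
  · have h1 : ⇑(Φ.trans S) ∘ v = (S : (Fin n → ℂ) →ₗ[ℝ] (Fin n → ℂ)) ∘ (Φ ∘ v) := rfl
    rw [h1, Module.Basis.det_comp]
    congr 1
    have h2 : (S : (Fin n → ℂ) →ₗ[ℝ] (Fin n → ℂ)) =
        LinearMap.pi fun i => (signConj (s i) : ℂ →ₗ[ℝ] ℂ) ∘ₗ LinearMap.proj i := rfl
    rw [h2, LinearMap.det_pi]
    simp only [det_signConj]
    push_cast
    rfl

variable {ρ : Torus k → E → E} {Λ₁ Λ₂ : Fin n → Fin k → ℤ}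
  (Φ₁ Φ₂ : E ≃ₗ[ℝ] (Fin n → ℂ))

theorem intertwiner_of_coordinates
    (h₁ : ∀ t w i, Φ₁ (ρ t w) i = torusChar (Λ₁ i) t * Φ₁ w i)
    (h₂ : ∀ t w i, Φ₂ (ρ t w) i = torusChar (Λ₂ i) t * Φ₂ w i) (t : Torus k) (z : Fin n → ℂ)
    (i : Fin n) :
    (Φ₁.symm.trans Φ₂) (fun j => torusChar (Λ₁ j) t * z j) i =
      torusChar (Λ₂ i) t * (Φ₁.symm.trans Φ₂) z i := by
  have h : (fun j => torusChar (Λ₁ j) t * z j) = Φ₁ (ρ t (Φ₁.symm z)) := by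
    funext j
    rw [h₁, LinearEquiv.apply_symm_apply]
  rw [h, LinearEquiv.trans_apply, LinearEquiv.symm_apply_apply, h₂]
  rfl

/-- Two complex structures commuting with the same real representation have the same weights up to
signs and numbering. -/
theorem exists_perm_sign_weights
    (h₁ : ∀ t w i, Φ₁ (ρ t w) i = torusChar (Λ₁ i) t * Φ₁ w i)
    (h₂ : ∀ t w i, Φ₂ (ρ t w) i = torusChar (Λ₂ i) t * Φ₂ w i)
    (hΛ₁ : ∀ i, Λ₁ i ≠ 0) (hΛ₂ : ∀ i, Λ₂ i ≠ 0) :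
    ∃ (σ : Equiv.Perm (Fin n)) (a : Fin n → ℤˣ), ∀ i, Λ₂ (σ i) = (a i : ℤ) • Λ₁ i := by
  choose s₁ hs₁ using fun i => exists_sign_smul_lex_pos (hΛ₁ i)
  choose s₂ hs₂ using fun i => exists_sign_smul_lex_pos (hΛ₂ i)
  obtain ⟨Φ₁', h₁', -⟩ := exists_conj_coordinates Φ₁ h₁ s₁
  obtain ⟨Φ₂', h₂', -⟩ := exists_conj_coordinates Φ₂ h₂ s₂
  obtain ⟨⟨σ, hσ⟩, -⟩ := intertwiner_perm_and_det_pos hs₁ hs₂ (Φ₁'.symm.trans Φ₂')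
    (intertwiner_of_coordinates Φ₁' Φ₂' h₁' h₂')
  refine ⟨σ, fun i => s₂ (σ i) * s₁ i, fun i => ?_⟩
  rw [Units.val_mul, mul_smul, ← hσ i, smul_smul, ← Units.val_mul, Int.units_mul_self,
    Units.val_one, one_smul]

/-- If the weights of two complex structures differ by the signs `a`, then their orientations differ
by the product of the `a i`. -/
theorem exists_pos_det_eq_prod_sign
    (h₁ : ∀ t w i, Φ₁ (ρ t w) i = torusChar (Λ₁ i) t * Φ₁ w i)
    (h₂ : ∀ t w i, Φ₂ (ρ t w) i = torusChar (Λ₂ i) t * Φ₂ w i)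
    (hΛ₁ : ∀ i, Λ₁ i ≠ 0) (a : Fin n → ℤˣ) (ha : ∀ i, Λ₂ i = (a i : ℤ) • Λ₁ i) :
    ∃ d : ℝ, 0 < d ∧ ∀ v : Fin (2 * n) → E, (complexStdRealBasis n).det (Φ₂ ∘ v) =
      d * (((∏ i, a i : ℤˣ) : ℤ) : ℝ) * (complexStdRealBasis n).det (Φ₁ ∘ v) := by
  choose s hs using fun i => exists_sign_smul_lex_pos (hΛ₁ i)
  have hs₂ : ∀ i, ((s i * a i : ℤˣ) : ℤ) • Λ₂ i = (s i : ℤ) • Λ₁ i := fun i => by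
    rw [ha, smul_smul, ← Units.val_mul, mul_assoc, Int.units_mul_self, mul_one]
  obtain ⟨Φ₁', h₁', hd₁⟩ := exists_conj_coordinates Φ₁ h₁ s
  obtain ⟨Φ₂', h₂', hd₂⟩ := exists_conj_coordinates Φ₂ h₂ (fun i => s i * a i)
  simp only [hs₂] at h₂'
  obtain ⟨-, hpos⟩ := intertwiner_perm_and_det_pos hs hs (Φ₁'.symm.trans Φ₂')
    (intertwiner_of_coordinates Φ₁' Φ₂' h₁' h₂')
  refine ⟨_, hpos, fun v => ?_⟩
  have h : Φ₂' ∘ v = ((Φ₁'.symm.trans Φ₂' : (Fin n → ℂ) ≃ₗ[ℝ] (Fin n → ℂ)) :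
      (Fin n → ℂ) →ₗ[ℝ] (Fin n → ℂ)) ∘ (Φ₁' ∘ v) := by
    funext i
    simp
  have hv := hd₂ v
  rw [h, Module.Basis.det_comp, hd₁, Finset.prod_mul_distrib] at hv
  have hsq : ∀ u : ℤˣ, ((u : ℤ) : ℝ) * ((u : ℤ) : ℝ) = 1 := fun u => by
    rcases Int.units_eq_one_or u with rfl | rfl <;> simp
  have hs2 := hsq (∏ i, s i)
  have ha2 := hsq (∏ i, a i)
  rw [Units.val_mul, Int.cast_mul] at hv
  generalize (((∏ i, s i : ℤˣ) : ℤ) : ℝ) = S at *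
  generalize (((∏ i, a i : ℤˣ) : ℤ) : ℝ) = A at *
  generalize LinearMap.det ((Φ₁'.symm.trans Φ₂' : (Fin n → ℂ) ≃ₗ[ℝ] (Fin n → ℂ)) :
    (Fin n → ℂ) →ₗ[ℝ] (Fin n → ℂ)) = D at *
  generalize (complexStdRealBasis n).det (Φ₂ ∘ v) = X at *
  generalize (complexStdRealBasis n).det (Φ₁ ∘ v) = Y at *
  linear_combination (-S * A) * hv + (D * A * Y - X) * hs2 - S * S * X * ha2

theorem coordinates_positive_iff_or_iff_not
    (h₁ : ∀ t w i, Φ₁ (ρ t w) i = torusChar (Λ₁ i) t * Φ₁ w i)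
    (h₂ : ∀ t w i, Φ₂ (ρ t w) i = torusChar (Λ₂ i) t * Φ₂ w i)
    (hΛ₁ : ∀ i, Λ₁ i ≠ 0) (a : Fin n → ℤˣ) (ha : ∀ i, Λ₂ i = (a i : ℤ) • Λ₁ i) :
    (∏ i, a i = 1 ∧ ∀ b : Module.Basis (Fin (2 * n)) ℝ E,
      0 < (complexStdRealBasis n).det (Φ₂ ∘ b) ↔ 0 < (complexStdRealBasis n).det (Φ₁ ∘ b)) ∨
    (∏ i, a i = -1 ∧ ∀ b : Module.Basis (Fin (2 * n)) ℝ E,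
      0 < (complexStdRealBasis n).det (Φ₂ ∘ b) ↔ ¬ 0 < (complexStdRealBasis n).det (Φ₁ ∘ b)) := by
  obtain ⟨d, hd, hdet⟩ := exists_pos_det_eq_prod_sign Φ₁ Φ₂ h₁ h₂ hΛ₁ a ha
  rcases Int.units_eq_one_or (∏ i, a i) with h | h
  · refine Or.inl ⟨h, fun b => ?_⟩
    rw [hdet, h]
    simp [hd]
  · refine Or.inr ⟨h, fun b => ?_⟩
    have hb := ((complexStdRealBasis n).isUnit_det (b.map Φ₁)).ne_zero
    rw [Module.Basis.coe_map] at hb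
    rw [hdet, h, not_lt, le_iff_lt_or_eq, or_iff_left hb]
    simp only [Units.val_neg, Units.val_one, Int.cast_neg, Int.cast_one, mul_neg, mul_one, neg_mul,
      neg_pos]
    exact ⟨fun h' => not_le.1 fun h0 => h'.not_ge (mul_nonneg hd.le h0),
      fun h' => mul_neg_of_pos_of_neg hd h'⟩

end Compare

/-! ### Weight bases of continuous representations of the torus -/

section Weights

open MeasureTheory

/-- The normalised Haar measure on `ℝ/ℤ`, for which Mathlib states Fourier theory. -/
noncomputable local instance unitAddCircleMeasureSpace : MeasureSpace UnitAddCircle :=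
  ⟨AddCircle.haarAddCircle⟩

local instance unitAddCircle_isAddHaarMeasure :
    Measure.IsAddHaarMeasure (volume : Measure UnitAddCircle) :=
  inferInstanceAs (Measure.IsAddHaarMeasure AddCircle.haarAddCircle)

local instance unitAddCircle_isProbabilityMeasure :
    IsProbabilityMeasure (volume : Measure UnitAddCircle) :=
  inferInstanceAs (IsProbabilityMeasure AddCircle.haarAddCircle)

variable {k : ℕ} {V : Type*} [NormedAddCommGroup V] [NormedSpace ℂ V] [FiniteDimensional ℂ V]
  {r : Torus k → V →ₗ[ℂ] V}

/-- The Fourier coefficient `∫ χ_Λ(x)⁻¹ r(x) v dx` of an orbit is a weight vector of weight `Λ`. -/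
theorem apply_mFourierCoeff_orbit (hmul : ∀ s t v, r (s * t) v = r s (r t v))
    (hc : ∀ v, Continuous fun t => r t v) (v : V) (Λ : Fin k → ℤ) (t : Torus k) :
    r t (UnitAddTorus.mFourierCoeff (fun x => r (torusOfAdd x) v) Λ) =
      torusChar Λ t • UnitAddTorus.mFourierCoeff (fun x => r (torusOfAdd x) v) Λ := by
  obtain ⟨s, rfl⟩ := torusOfAdd_surjective t
  have hcont : Continuous fun x : UnitAddTorus (Fin k) =>
      UnitAddTorus.mFourier (-Λ) x • r (torusOfAdd x) v :=
    (UnitAddTorus.mFourier (-Λ)).continuous.smul ((hc v).comp continuous_torusOfAdd)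
  have hint : Integrable (fun x : UnitAddTorus (Fin k) =>
      UnitAddTorus.mFourier (-Λ) x • r (torusOfAdd x) v) :=
    hcont.integrable_of_hasCompactSupport (HasCompactSupport.of_compactSpace _)
  have h1 : r (torusOfAdd s) (UnitAddTorus.mFourierCoeff (fun x => r (torusOfAdd x) v) Λ) =
      ∫ x, r (torusOfAdd s) (UnitAddTorus.mFourier (-Λ) x • r (torusOfAdd x) v) :=
    ((LinearMap.toContinuousLinearMap (r (torusOfAdd s))).integral_comp_comm hint).symm
  have h2 : ∀ x, r (torusOfAdd s) (UnitAddTorus.mFourier (-Λ) x • r (torusOfAdd x) v) =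
      UnitAddTorus.mFourier Λ s •
        (UnitAddTorus.mFourier (-Λ) (s + x) • r (torusOfAdd (s + x)) v) := by
    intro x
    have hs : UnitAddTorus.mFourier Λ s * UnitAddTorus.mFourier (-Λ) s = 1 := by
      rw [← UnitAddTorus.mFourier_add, add_neg_cancel, UnitAddTorus.mFourier_zero]
      rfl
    have hx : UnitAddTorus.mFourier (-Λ) (s + x) =
        UnitAddTorus.mFourier (-Λ) s * UnitAddTorus.mFourier (-Λ) x := by
      simp [UnitAddTorus.mFourier, Finset.prod_mul_distrib, AddCircle.toCircle_add]
    rw [map_smul, torusOfAdd_add, hmul, hx, smul_smul, ← mul_assoc, hs, one_mul]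
  rw [h1, torusChar_torusOfAdd]
  simp only [h2]
  rw [integral_smul]
  congr 1
  exact integral_add_left_eq_self
    (fun x => UnitAddTorus.mFourier (-Λ) x • r (torusOfAdd x) v) s

theorem eq_zero_of_mFourierCoeff_eq_zero (f : C(UnitAddTorus (Fin k), ℂ))
    (hf : UnitAddTorus.mFourierCoeff f = 0) : f = 0 := by
  have hs := UnitAddTorus.hasSum_mFourier_series_of_summable (f := f)
    (by rw [hf]; exact summable_zero)
  have h0 : (fun i => UnitAddTorus.mFourierCoeff f i • UnitAddTorus.mFourier i) =
      fun _ => (0 : C(UnitAddTorus (Fin k), ℂ)) := by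
    funext i
    rw [hf]
    exact zero_smul ℂ (UnitAddTorus.mFourier i)
  rw [h0] at hs
  exact hs.unique hasSum_zero

/-- A linear form vanishing on all weight vectors vanishes: its matrix coefficients along the torus
are continuous functions all of whose Fourier coefficients are zero. -/
theorem span_weightVectors_eq_top (hmul : ∀ s t v, r (s * t) v = r s (r t v))
    (hone : ∀ v, r 1 v = v) (hc : ∀ v, Continuous fun t => r t v) :
    Submodule.span ℂ {v : V | ∃ Λ : Fin k → ℤ, ∀ t, r t v = torusChar Λ t • v} = ⊤ := by
  by_contra hne
  obtain ⟨ℓ, hℓ, hker⟩ := Submodule.exists_le_ker_of_lt_top _ (lt_top_iff_ne_top.2 hne)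
  refine hℓ (LinearMap.ext fun v => ?_)
  have hco : Continuous fun x : UnitAddTorus (Fin k) => r (torusOfAdd x) v :=
    (hc v).comp continuous_torusOfAdd
  let f : C(UnitAddTorus (Fin k), ℂ) :=
    ⟨fun x => ℓ (r (torusOfAdd x) v), ℓ.continuous_of_finiteDimensional.comp hco⟩
  have hf : UnitAddTorus.mFourierCoeff f = 0 := by
    funext Λ
    have hint : Integrable (fun x : UnitAddTorus (Fin k) =>
        UnitAddTorus.mFourier (-Λ) x • r (torusOfAdd x) v) :=
      ((UnitAddTorus.mFourier (-Λ)).continuous.smul hco).integrable_of_hasCompactSupport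
        (HasCompactSupport.of_compactSpace _)
    have h1 : UnitAddTorus.mFourierCoeff f Λ =
        ℓ (UnitAddTorus.mFourierCoeff (fun x => r (torusOfAdd x) v) Λ) := by
      refine Eq.trans ?_
        ((LinearMap.toContinuousLinearMap ℓ).integral_comp_comm hint)
      refine integral_congr_ae (Filter.Eventually.of_forall fun x => ?_)
      exact (map_smul ℓ _ _).symm
    rw [h1]
    exact hker (Submodule.subset_span ⟨Λ, fun t => apply_mFourierCoeff_orbit hmul hc v Λ t⟩)
  have h0 : f = 0 := eq_zero_of_mFourierCoeff_eq_zero f hf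
  have h1 : f 0 = ℓ v := by
    change ℓ (r (torusOfAdd 0) v) = ℓ v
    rw [torusOfAdd_zero, hone]
  rw [← h1, h0]
  rfl

theorem exists_weight_basis {n : ℕ} (hn : Module.finrank ℂ V = n)
    (hmul : ∀ s t v, r (s * t) v = r s (r t v))
    (hone : ∀ v, r 1 v = v) (hc : ∀ v, Continuous fun t => r t v) :
    ∃ (b : Module.Basis (Fin n) ℂ V) (Λ : Fin n → Fin k → ℤ),
      ∀ i t, r t (b i) = torusChar (Λ i) t • b i := by
  let B := Module.Basis.ofSpan (span_weightVectors_eq_top hmul hone hc).ge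
  have hB := Module.Basis.ofSpan_subset (span_weightVectors_eq_top hmul hone hc).ge
  have := Module.Finite.finite_basis B
  have := Fintype.ofFinite
    ↑((linearIndepOn_empty ℂ id).extend (Set.empty_subset
      {v : V | ∃ Λ : Fin k → ℤ, ∀ t, r t v = torusChar Λ t • v}))
  let e := Fintype.equivFinOfCardEq ((Module.finrank_eq_card_basis B).symm.trans hn)
  have hw : ∀ i, ∃ Λ : Fin k → ℤ, ∀ t, r t ((B.reindex e) i) =
      torusChar Λ t • (B.reindex e) i := fun i => by
    rw [Module.Basis.reindex_apply]
    exact hB (Set.mem_range_self _)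
  choose Λ hΛ using hw
  exact ⟨B.reindex e, Λ, hΛ⟩

end Weights

/-! ### Linearisation at a fixed point -/

section Linearisation

open MeasureTheory

variable {G E : Type*} [CommGroup G] [TopologicalSpace G] [IsTopologicalGroup G]
  [NormedAddCommGroup E] [NormedSpace ℝ E] {g : G → E → E} {D : G → E → E →L[ℝ] E} {y₀ : E}

theorem continuous_linearisation_integrand (hD : ∀ t, ContinuousAt (Function.uncurry D) (t, y₀))
    {y : E} (hy : Continuous fun t => g t y) :
    Continuous fun t => D t⁻¹ y₀ (g t y - y₀) := by
  have h : Continuous fun t => D t y₀ := continuous_iff_continuousAt.2 fun t =>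
    (hD t).comp (f := fun t => (t, y₀)) (by fun_prop)
  exact (h.comp continuous_inv).clm_apply (hy.sub continuous_const)

variable [CompactSpace G] [FiniteDimensional ℝ E] [MeasurableSpace G] [BorelSpace G]
  {μ : Measure G} [IsProbabilityMeasure μ]

/-- The average of a local action over the group, twisted by its differential at the fixed point
`y₀`. -/
noncomputable def linearisation (μ : Measure G) (g : G → E → E) (D : G → E → E →L[ℝ] E)
    (y₀ y : E) : E :=
  ∫ t, D t⁻¹ y₀ (g t y - y₀) ∂μ

/-- The derivatives of the integrands are close to the identity uniformly over the compact group,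
so that their average is strictly differentiable. -/
theorem hasStrictFDerivAt_linearisation
    (hg : ∀ᶠ y in 𝓝 y₀, ∀ t, HasFDerivAt (g t) (D t y) y)
    (hD : ∀ t, ContinuousAt (Function.uncurry D) (t, y₀))
    (hinv : ∀ t w, D t⁻¹ y₀ (D t y₀ w) = w)
    (hcont : ∀ᶠ y in 𝓝 y₀, Continuous fun t => g t y) :
    HasStrictFDerivAt (linearisation μ g D y₀) (ContinuousLinearMap.id ℝ E) y₀ := by
  rw [hasStrictFDerivAt_iff_isLittleO, Asymptotics.isLittleO_iff]
  intro ε hε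
  have hDc : Continuous fun t => D t y₀ := continuous_iff_continuousAt.2 fun t =>
    (hD t).comp (f := fun t => (t, y₀)) (by fun_prop)
  have hunif : ∀ᶠ y in 𝓝 y₀, ∀ t ∈ (Set.univ : Set G),
      ‖(D t⁻¹ y₀).comp (D t y) - ContinuousLinearMap.id ℝ E‖ < ε := by
    refine isCompact_univ.eventually_forall_of_forall_eventually fun t _ => ?_
    have h1 : ContinuousAt (fun z : E × G =>
        ‖(D z.2⁻¹ y₀).comp (D z.2 z.1) - ContinuousLinearMap.id ℝ E‖) (y₀, t) := by
      have h2 : ContinuousAt (fun z : E × G => D z.2⁻¹ y₀) (y₀, t) :=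
        (hDc.comp (continuous_inv.comp continuous_snd)).continuousAt
      have h3 : ContinuousAt (fun z : E × G => D z.2 z.1) (y₀, t) :=
        (hD t).comp (f := fun z : E × G => (z.2, z.1)) (x := (y₀, t))
          (continuous_swap.continuousAt)
      exact ((h2.clm_comp h3).sub continuousAt_const).norm
    refine h1.eventually_lt continuousAt_const ?_
    have h4 : (D t⁻¹ y₀).comp (D t y₀) = ContinuousLinearMap.id ℝ E :=
      ContinuousLinearMap.ext fun w => hinv t w
    simpa [h4] using hε
  obtain ⟨δ, hδ, hball⟩ := Metric.eventually_nhds_iff_ball.1 (hunif.and (hg.and hcont))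
  have hprod : ∀ᶠ z : E × E in 𝓝 (y₀, y₀), z.1 ∈ Metric.ball y₀ δ ∧ z.2 ∈ Metric.ball y₀ δ := by
    rw [nhds_prod_eq]
    exact (Filter.Eventually.prod_inl (Metric.ball_mem_nhds y₀ hδ) _).and
      (Filter.Eventually.prod_inr (Metric.ball_mem_nhds y₀ hδ) _)
  filter_upwards [hprod] with z hz
  have hI : ∀ y ∈ Metric.ball y₀ δ, Integrable (fun t => D t⁻¹ y₀ (g t y - y₀)) μ := fun y hy =>
    (continuous_linearisation_integrand hD (hball y hy).2.2).integrable_of_hasCompactSupport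
      (HasCompactSupport.of_compactSpace _)
  have h1 : linearisation μ g D y₀ z.1 - linearisation μ g D y₀ z.2 -
      (ContinuousLinearMap.id ℝ E) (z.1 - z.2) =
      ∫ t, (D t⁻¹ y₀ (g t z.1 - y₀) - D t⁻¹ y₀ (g t z.2 - y₀) - (z.1 - z.2)) ∂μ := by
    have hsub : Integrable
        (fun t => D t⁻¹ y₀ (g t z.1 - y₀) - D t⁻¹ y₀ (g t z.2 - y₀)) μ :=
      (hI _ hz.1).sub (hI _ hz.2)
    rw [integral_sub hsub (integrable_const _),
      integral_sub (hI _ hz.1) (hI _ hz.2)]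
    simp [linearisation]
  rw [h1]
  have hbound : ∀ t, ‖D t⁻¹ y₀ (g t z.1 - y₀) - D t⁻¹ y₀ (g t z.2 - y₀) - (z.1 - z.2)‖ ≤
      ε * ‖z.1 - z.2‖ := fun t =>
    (convex_ball y₀ δ).norm_image_sub_le_of_norm_hasFDerivWithin_le'
      (f := fun y => D t⁻¹ y₀ (g t y - y₀)) (f' := fun y => (D t⁻¹ y₀).comp (D t y))
      (φ := ContinuousLinearMap.id ℝ E)
      (fun y hy => ((D t⁻¹ y₀).hasFDerivAt.comp y
        (((hball y hy).2.1 t).sub_const y₀)).hasFDerivWithinAt)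
      (fun y hy => ((hball y hy).1 t trivial).le) hz.2 hz.1
  simpa using norm_integral_le_of_norm_le_const (μ := μ) (Filter.Eventually.of_forall hbound)

theorem linearisation_apply_smul [μ.IsMulRightInvariant]
    (hD : ∀ t, ContinuousAt (Function.uncurry D) (t, y₀))
    (hmul : ∀ s t w, D (s * t) y₀ w = D s y₀ (D t y₀ w)) {y : E}
    (hcont : Continuous fun t => g t y) (hact : ∀ s t, g s (g t y) = g (s * t) y) (s : G) :
    linearisation μ g D y₀ (g s y) = D s y₀ (linearisation μ g D y₀ y) := by
  have hI : Integrable (fun t => D t⁻¹ y₀ (g t y - y₀)) μ :=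
    (continuous_linearisation_integrand hD hcont).integrable_of_hasCompactSupport
      (HasCompactSupport.of_compactSpace _)
  rw [linearisation, linearisation, ← ContinuousLinearMap.integral_comp_comm _ hI]
  rw [← integral_mul_right_eq_self (fun t => D s y₀ (D t⁻¹ y₀ (g t y - y₀))) s]
  refine integral_congr_ae (Filter.Eventually.of_forall fun t => ?_)
  have h : t⁻¹ = s * (t * s)⁻¹ := by
    rw [mul_inv, mul_comm t⁻¹, mul_inv_cancel_left]
  change D t⁻¹ y₀ (g t (g s y) - y₀) = D s y₀ (D (t * s)⁻¹ y₀ (g (t * s) y - y₀))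
  rw [hact, ← hmul, ← h]

/-- A nonzero vector fixed by the differential of a local action of a compact group at a fixed point
gives a curve of fixed points: the preimage of its line under the linearisation. -/
theorem frequently_fixed_of_fixed_vector [μ.IsMulRightInvariant]
    (hg : ∀ᶠ y in 𝓝 y₀, ∀ t, HasFDerivAt (g t) (D t y) y)
    (hD : ∀ t, ContinuousAt (Function.uncurry D) (t, y₀))
    (hmul : ∀ s t w, D (s * t) y₀ w = D s y₀ (D t y₀ w)) (hone : ∀ w, D 1 y₀ w = w)
    (hcont : ∀ᶠ y in 𝓝 y₀, Continuous fun t => g t y)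
    (hact : ∀ᶠ y in 𝓝 y₀, ∀ s t, g s (g t y) = g (s * t) y)
    (hfix : ∀ t, g t y₀ = y₀) (htube : ∀ U ∈ 𝓝 y₀, ∀ᶠ y in 𝓝 y₀, ∀ t, g t y ∈ U)
    {w : E} (hw : w ≠ 0) (hDw : ∀ t, D t y₀ w = w) :
    ∃ᶠ y in 𝓝[≠] y₀, ∀ t, g t y = y := by
  have hinv : ∀ t w, D t⁻¹ y₀ (D t y₀ w) = w := fun t w => by
    rw [← hmul, inv_mul_cancel, hone]
  have hstr : HasStrictFDerivAt (linearisation μ g D y₀)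
      ((ContinuousLinearEquiv.refl ℝ E : E ≃L[ℝ] E) : E →L[ℝ] E) y₀ :=
    hasStrictFDerivAt_linearisation hg hD hinv hcont
  have hF0 : linearisation μ g D y₀ y₀ = 0 := by
    simp [linearisation, hfix]
  let Φ := hstr.toOpenPartialHomeomorph
  have hΦ : ∀ y, Φ y = linearisation μ g D y₀ y := fun y => rfl
  have hsrc : Φ.source ∈ 𝓝 y₀ := Φ.open_source.mem_nhds hstr.mem_toOpenPartialHomeomorph_source
  have h0 : (0 : E) ∈ Φ.target := hF0 ▸ hstr.image_mem_toOpenPartialHomeomorph_target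
  have hsymm0 : Φ.symm 0 = y₀ := by
    rw [← hF0, ← hΦ]
    exact Φ.left_inv hstr.mem_toOpenPartialHomeomorph_source
  let γ : ℝ → E := fun c => Φ.symm (c • w)
  have hline : Filter.Tendsto (fun c : ℝ => c • w) (𝓝 0) (𝓝 0) := by
    have : ContinuousAt (fun c : ℝ => c • w) 0 := by fun_prop
    simpa using this.tendsto
  have hγ : Filter.Tendsto γ (𝓝 0) (𝓝 y₀) := by
    have := (Φ.continuousAt_symm h0).tendsto.comp hline
    rwa [hsymm0] at this
  have htgt : ∀ᶠ c : ℝ in 𝓝 0, c • w ∈ Φ.target := hline (Φ.open_target.mem_nhds h0)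
  have hγΦ : ∀ᶠ c : ℝ in 𝓝 0, Φ (γ c) = c • w := htgt.mono fun c hc => Φ.right_inv hc
  have hγne : Filter.Tendsto γ (𝓝[≠] 0) (𝓝[≠] y₀) := by
    refine tendsto_nhdsWithin_iff.2 ⟨hγ.mono_left nhdsWithin_le_nhds, ?_⟩
    filter_upwards [hγΦ.filter_mono nhdsWithin_le_nhds, self_mem_nhdsWithin] with c hc hc0 heq
    have heq' : γ c = y₀ := heq
    rw [heq', hΦ, hF0] at hc
    exact smul_ne_zero hc0 hw hc.symm
  have hev : ∀ᶠ c : ℝ in 𝓝 0, ∀ t, g t (γ c) = γ c := by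
    filter_upwards [hγΦ, htgt, hγ (htube _ hsrc), hγ hcont, hγ hact] with c hc hct hcU hcc hca t
    refine Φ.injOn (hcU t) (Φ.map_target hct) ?_
    rw [hΦ, linearisation_apply_smul hD hmul hcc hca, ← hΦ, hc, map_smul, hDw]
  exact hγne.frequently (hev.filter_mono nhdsWithin_le_nhds).frequently

end Linearisation

section Manifold

open MeasureTheory

variable {n k : ℕ} {M : Type*} [TopologicalSpace M]
  [ChartedSpace (EuclideanSpace ℝ (Fin (2 * n))) M] [IsManifold (𝓡 (2 * n)) ∞ M]
  [MulAction (Torus k) M]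

theorem isOpenQuotientMap_torusExp (k : ℕ) :
    IsOpenQuotientMap (fun (x : Fin k → ℝ) (i : Fin k) => Circle.exp (x i)) := by
  refine ⟨fun t => ⟨fun i => (t i : ℂ).arg, funext fun i => Circle.exp_arg (t i)⟩,
    continuous_pi fun i => Circle.exp.continuous.comp (continuous_apply i),
    IsOpenMap.piMap (f := fun (_ : Fin k) => ⇑Circle.exp)
      (fun i => isLocalHomeomorph_circleExp.isOpenMap) ?_⟩
  simp

/-- The action of the torus read in the preferred chart at `p`. -/
noncomputable def chartAction (n : ℕ) {k : ℕ} {M : Type*} [TopologicalSpace M]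
    [ChartedSpace (EuclideanSpace ℝ (Fin (2 * n))) M] [MulAction (Torus k) M] (p : M)
    (t : Torus k) (y : EuclideanSpace ℝ (Fin (2 * n))) : EuclideanSpace ℝ (Fin (2 * n)) :=
  extChartAt (𝓡 (2 * n)) p (t • (extChartAt (𝓡 (2 * n)) p).symm y)

variable [ContMDiffSMul (torusModel k) (𝓡 (2 * n)) ∞ (Torus k) M]

theorem contDiffAt_chartAction (p : M) (x₀ : Fin k → ℝ) {y₁ : EuclideanSpace ℝ (Fin (2 * n))}
    (hy : y₁ ∈ (extChartAt (𝓡 (2 * n)) p).target)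
    (hs : (fun i => Circle.exp (x₀ i) : Torus k) • (extChartAt (𝓡 (2 * n)) p).symm y₁ ∈
      (extChartAt (𝓡 (2 * n)) p).source) :
    ContDiffAt ℝ ∞ (fun z : (Fin k → ℝ) × EuclideanSpace ℝ (Fin (2 * n)) =>
      chartAction n p (fun i => Circle.exp (z.1 i) : Torus k) z.2) (x₀, y₁) := by
  rw [← contMDiffAt_iff_contDiffAt]
  have h1 : ContMDiffAt 𝓘(ℝ, (Fin k → ℝ) × EuclideanSpace ℝ (Fin (2 * n))) (torusModel k) ∞
      (fun z : (Fin k → ℝ) × EuclideanSpace ℝ (Fin (2 * n)) =>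
        (fun i => Circle.exp (z.1 i) : Torus k)) (x₀, y₁) :=
    ((EquivariantStableComplexStructure.contMDiff_torusExp k).comp
      contDiff_fst.contMDiff).contMDiffAt
  have h2 : ContMDiffAt 𝓘(ℝ, (Fin k → ℝ) × EuclideanSpace ℝ (Fin (2 * n))) (𝓡 (2 * n)) ∞
      (fun z : (Fin k → ℝ) × EuclideanSpace ℝ (Fin (2 * n)) =>
        (extChartAt (𝓡 (2 * n)) p).symm z.2) (x₀, y₁) := by
    have h3 : ContMDiffAt 𝓘(ℝ, EuclideanSpace ℝ (Fin (2 * n))) (𝓡 (2 * n)) ∞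
        (extChartAt (𝓡 (2 * n)) p).symm y₁ :=
      (contMDiffOn_extChartAt_symm p).contMDiffAt
        ((isOpen_extChartAt_target p).mem_nhds hy)
    exact h3.comp (x₀, y₁) (contDiff_snd.contMDiff.contMDiffAt)
  have h4 : ContMDiffAt 𝓘(ℝ, (Fin k → ℝ) × EuclideanSpace ℝ (Fin (2 * n))) (𝓡 (2 * n)) ∞
      (fun z : (Fin k → ℝ) × EuclideanSpace ℝ (Fin (2 * n)) =>
        (fun i => Circle.exp (z.1 i) : Torus k) • (extChartAt (𝓡 (2 * n)) p).symm z.2)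
      (x₀, y₁) :=
    ContMDiffAt.comp (I' := (torusModel k).prod (𝓡 (2 * n))) (x₀, y₁)
      (g := fun q : Torus k × M => q.1 • q.2)
      (contMDiff_smul (I := torusModel k) (I' := 𝓡 (2 * n)) (n := ∞) (G := Torus k)
        (M := M)).contMDiffAt (h1.prodMk h2)
  rw [extChartAt_source] at hs
  exact (contMDiffAt_extChartAt' hs).comp (x₀, y₁) h4

theorem tangentRep_eq_fderiv_chartAction {p : M} (hp : ∀ t : Torus k, t • p = p) (t : Torus k) :
    fderiv ℝ (chartAction n p t) (extChartAt (𝓡 (2 * n)) p p) =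
      EquivariantStableComplexStructure.tangentRep n p t := by
  have hd : MDifferentiableAt (𝓡 (2 * n)) (𝓡 (2 * n)) (fun y : M => t • y) p :=
    (EquivariantStableComplexStructure.contMDiff_torus_smul t).contMDiffAt.mdifferentiableAt
      (by simp)
  rw [EquivariantStableComplexStructure.tangentRep, hd.mfderiv]
  simp only [writtenInExtChartAt, ModelWithCorners.range_eq_univ, fderivWithin_univ]
  rw [hp t]
  rfl

/-- The differential of the action at an isolated fixed point has no nonzero fixed vector. -/
theorem eq_zero_of_tangentRep_fixed {p : M} (hp : ∀ t : Torus k, t • p = p)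
    (hiso : ∀ᶠ q in 𝓝[≠] p, ¬ ∀ t : Torus k, t • q = q)
    {w : EuclideanSpace ℝ (Fin (2 * n))}
    (hw : ∀ t : Torus k, EquivariantStableComplexStructure.tangentRep n p t w = w) : w = 0 := by
  by_contra hw0
  let : MeasurableSpace (Torus k) := borel _
  have : BorelSpace (Torus k) := ⟨rfl⟩
  let μ : Measure (Torus k) := Measure.haarMeasure ⊤
  have : IsProbabilityMeasure μ := ⟨Measure.haarMeasure_self⟩
  let φ := extChartAt (𝓡 (2 * n)) p
  let y₀ := φ p
  have hcs : Continuous fun q : Torus k × M => q.1 • q.2 :=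
    (contMDiff_smul (I := torusModel k) (I' := 𝓡 (2 * n)) (n := ∞) (G := Torus k)
      (M := M)).continuous
  have hy₀ : φ.symm y₀ = p := extChartAt_to_inv p
  have hφsymm : Filter.Tendsto φ.symm (𝓝 y₀) (𝓝 p) := by
    have h := (continuousAt_extChartAt_symm (I := 𝓡 (2 * n)) p).tendsto
    rwa [extChartAt_to_inv] at h
  have hsource : φ.source ∈ 𝓝 p := extChartAt_source_mem_nhds p
  have htarget : φ.target ∈ 𝓝 y₀ :=
    (isOpen_extChartAt_target p).mem_nhds (mem_extChartAt_target p)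
  -- By compactness of the torus, neighbourhoods of `p` contain whole orbits of nearby points.
  have horbit : ∀ U ∈ 𝓝 p, ∀ᶠ q in 𝓝 p, ∀ t : Torus k, t • q ∈ U := by
    intro U hU
    have h : ∀ᶠ q in 𝓝 p, ∀ t ∈ (Set.univ : Set (Torus k)), t • q ∈ U := by
      refine isCompact_univ.eventually_forall_of_forall_eventually fun t _ => ?_
      have h1 : ContinuousAt (fun z : M × Torus k => z.2 • z.1) (p, t) :=
        (hcs.comp continuous_swap).continuousAt
      refine h1.tendsto ?_
      change U ∈ 𝓝 (t • p)
      rwa [hp]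
    exact h.mono fun q hq t => hq t trivial
  have hgood : ∀ᶠ y in 𝓝 y₀, y ∈ φ.target ∧ ∀ t : Torus k, t • φ.symm y ∈ φ.source :=
    Filter.Eventually.and htarget (hφsymm (horbit _ hsource))
  have hq := isOpenQuotientMap_torusExp k
  let D : Torus k → EuclideanSpace ℝ (Fin (2 * n)) →
      EuclideanSpace ℝ (Fin (2 * n)) →L[ℝ] EuclideanSpace ℝ (Fin (2 * n)) :=
    fun t y => fderiv ℝ (chartAction n p t) y
  have hDρ : ∀ t, D t y₀ = EquivariantStableComplexStructure.tangentRep n p t :=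
    tangentRep_eq_fderiv_chartAction hp
  have hg : ∀ᶠ y in 𝓝 y₀, ∀ t, HasFDerivAt (chartAction n p t) (D t y) y := by
    filter_upwards [hgood] with y hy t
    obtain ⟨x, rfl⟩ := hq.surjective t
    have h1 := (contDiffAt_chartAction p x hy.1 (hy.2 _)).differentiableAt (by simp)
    exact (h1.comp (f := fun y' => (x, y')) y (by fun_prop)).hasFDerivAt
  -- Smoothness is only available in the exponential coordinates, whose openness allows descent to
  -- the torus.
  have hD : ∀ t, ContinuousAt (Function.uncurry D) (t, y₀) := by
    intro t
    obtain ⟨x, rfl⟩ := hq.surjective t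
    have hmap : IsOpenMap (Prod.map (fun (x : Fin k → ℝ) (i : Fin k) => Circle.exp (x i))
        (id : EuclideanSpace ℝ (Fin (2 * n)) → _)) := hq.isOpenMap.prodMap IsOpenMap.id
    have h0 : ContDiffAt ℝ ∞ (fun z : (Fin k → ℝ) × EuclideanSpace ℝ (Fin (2 * n)) =>
        chartAction n p (fun i => Circle.exp (z.1 i) : Torus k) z.2) (x, y₀) :=
      contDiffAt_chartAction p x (mem_extChartAt_target p)
        (by rw [hy₀, hp]; exact mem_extChartAt_source p)
    have h1 : ContinuousAt (fun z : (Fin k → ℝ) × EuclideanSpace ℝ (Fin (2 * n)) =>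
        D (fun i => Circle.exp (z.1 i)) z.2) (x, y₀) := by
      refine (ContDiffAt.fderiv (m := 0) (n := ∞)
        (f := fun (z : (Fin k → ℝ) × EuclideanSpace ℝ (Fin (2 * n))) y' =>
          chartAction n p (fun i => Circle.exp (z.1 i) : Torus k) y')
        (g := Prod.snd) (x₀ := (x, y₀)) ?_ contDiffAt_snd (by simp)).continuousAt
      exact h0.comp ((x, y₀), y₀) (f := fun z => (z.1.1, z.2)) (by fun_prop)
    have h2 : Filter.Tendsto (Function.uncurry D)
        (Filter.map (Prod.map (fun (x : Fin k → ℝ) (i : Fin k) => Circle.exp (x i)) id)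
          (𝓝 (x, y₀))) (𝓝 (D (fun i => Circle.exp (x i)) y₀)) := Filter.tendsto_map'_iff.2 h1
    exact h2.mono_left (hmap.nhds_le (x, y₀))
  have hact : ∀ᶠ y in 𝓝 y₀, ∀ s t : Torus k,
      chartAction n p s (chartAction n p t y) = chartAction n p (s * t) y := by
    filter_upwards [hgood] with y hy s t
    change φ (s • φ.symm (φ (t • φ.symm y))) = φ ((s * t) • φ.symm y)
    rw [φ.left_inv (hy.2 t), mul_smul]
  have hcont : ∀ᶠ y in 𝓝 y₀, Continuous fun t : Torus k => chartAction n p t y := by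
    filter_upwards [hgood] with y hy
    exact (continuousOn_extChartAt p).comp_continuous
      (hcs.comp (continuous_id.prodMk continuous_const)) hy.2
  have htube : ∀ U ∈ 𝓝 y₀, ∀ᶠ y in 𝓝 y₀, ∀ t : Torus k, chartAction n p t y ∈ U :=
    fun U hU => hφsymm (horbit _ ((continuousAt_extChartAt p) hU))
  have hfreq := frequently_fixed_of_fixed_vector (μ := μ) hg hD
    (fun s t w => by simp only [hDρ]; exact
      EquivariantStableComplexStructure.tangentRep_mul hp s t w)
    (fun w => by rw [hDρ]; exact EquivariantStableComplexStructure.tangentRep_one p w)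
    hcont hact (fun t => by change φ (t • φ.symm y₀) = y₀; rw [hy₀, hp]) htube hw0
    (fun t => by rw [hDρ]; exact hw t)
  have hne : Filter.Tendsto φ.symm (𝓝[≠] y₀) (𝓝[≠] p) := by
    refine tendsto_nhdsWithin_iff.2 ⟨hφsymm.mono_left nhdsWithin_le_nhds, ?_⟩
    filter_upwards [nhdsWithin_le_nhds htarget, self_mem_nhdsWithin] with y hy hy' heq
    have heq' : φ.symm y = p := heq
    exact hy' (by rw [Set.mem_singleton_iff, ← φ.right_inv hy, heq'])
  obtain ⟨y, ⟨hyf, hygood⟩, hy⟩ :=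
    ((hfreq.and_eventually (hgood.filter_mono nhdsWithin_le_nhds)).and_eventually
      (hne.eventually hiso)).exists
  refine hy fun t => φ.injOn (hygood.2 t) (φ.map_target hygood.1) ?_
  rw [φ.right_inv hygood.1]
  exact hyf t

end Manifold

/-! ### Orientations of real vector spaces as predicates on bases -/

section OrientationPredicate

variable {ι E : Type*} [Fintype ι] [DecidableEq ι] [AddCommGroup E] [Module ℝ E]

/-- A predicate on bases is the positivity for one of the two orientations. -/
def IsOrientationPredicate (P : Module.Basis ι ℝ E → Prop) : Prop :=
  ∃ (b₀ : Module.Basis ι ℝ E) (κ : ℝ), κ ≠ 0 ∧ ∀ b, P b ↔ 0 < κ * b₀.det b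

variable {P Q : Module.Basis ι ℝ E → Prop}

/-- If determinants of the frames `w b` scale as those of `b`, then their positivity is an
orientation. -/
theorem isOrientationPredicate_of_det {κ : Type*} [Fintype κ] [DecidableEq κ] {V : Type*}
    [AddCommGroup V] [Module ℝ V] (b₀ : Module.Basis ι ℝ E) (B : Module.Basis κ ℝ V)
    (w : (ι → E) → κ → V) (h0 : B.det (w b₀) ≠ 0)
    (hw : ∀ (T : E →ₗ[ℝ] E) (v : ι → E), B.det (w (T ∘ v)) = LinearMap.det T * B.det (w v)) :
    IsOrientationPredicate fun b : Module.Basis ι ℝ E => 0 < B.det (w b) := by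
  refine ⟨b₀, _, h0, fun b => ?_⟩
  let T : E ≃ₗ[ℝ] E := b₀.equiv b (Equiv.refl ι)
  have hT : ⇑b = (T : E →ₗ[ℝ] E) ∘ b₀ := by
    funext i
    simp [T]
  change 0 < B.det (w b) ↔ _
  rw [hT, hw, Module.Basis.det_comp, Module.Basis.det_self, mul_one, mul_comm]

theorem IsOrientationPredicate.iff_of_iff (hP : IsOrientationPredicate P)
    (hQ : IsOrientationPredicate Q) {b₁ : Module.Basis ι ℝ E} (h : P b₁ ↔ Q b₁)
    (b : Module.Basis ι ℝ E) : P b ↔ Q b := by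
  obtain ⟨b₀, κ, hκ, hP⟩ := hP
  obtain ⟨b₀', κ', hκ', hQ⟩ := hQ
  have hd : ∀ b c : Module.Basis ι ℝ E, b.det c ≠ 0 := fun b c => (b.isUnit_det c).ne_zero
  have hch : ∀ c, b₀'.det c = b₀'.det b₁ * b₁.det c := fun c => by
    conv_lhs => rw [AlternatingMap.eq_smul_basis_det b₁ b₀'.det]
    rfl
  have hch₀ : ∀ c, b₀.det c = b₀.det b₁ * b₁.det c := fun c => by
    conv_lhs => rw [AlternatingMap.eq_smul_basis_det b₁ b₀.det]
    rfl
  rw [hP, hQ] at h ⊢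
  rw [hch b, hch₀ b, ← mul_assoc, ← mul_assoc]
  have h1 := mul_ne_zero hκ (hd b₀ b₁)
  have h2 := mul_ne_zero hκ' (hd b₀' b₁)
  rcases h1.lt_or_gt with h1 | h1 <;> rcases h2.lt_or_gt with h2 | h2
  · simp only [mul_pos_iff, h1, h1.not_gt, h2, h2.not_gt]
  · exact absurd (h.2 h2) h1.not_gt
  · exact absurd (h.1 h1) h2.not_gt
  · rw [mul_pos_iff_of_pos_left h1, mul_pos_iff_of_pos_left h2]

theorem IsOrientationPredicate.not (hP : IsOrientationPredicate P) :
    IsOrientationPredicate fun b => ¬ P b := by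
  obtain ⟨b₀, κ, hκ, hP⟩ := hP
  refine ⟨b₀, -κ, neg_ne_zero.2 hκ, fun b => ?_⟩
  have h : κ * b₀.det b ≠ 0 := mul_ne_zero hκ (b₀.isUnit_det b).ne_zero
  change ¬ P b ↔ _
  rw [hP, neg_mul, neg_pos, not_lt]
  exact ⟨fun h' => lt_of_le_of_ne h' h, le_of_lt⟩

theorem IsOrientationPredicate.iff_not_of_not_forall_iff (hP : IsOrientationPredicate P)
    (hQ : IsOrientationPredicate Q) (h : ¬ ∀ b, P b ↔ Q b) (b : Module.Basis ι ℝ E) :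
    P b ↔ ¬ Q b := by
  obtain ⟨b₁, hb₁⟩ := not_forall.1 h
  exact hP.iff_of_iff hQ.not (b₁ := b₁) (by tauto) b

end OrientationPredicate

/-! ### Orientations defined by stable complex structures -/

section StableFrame

variable {p q : ℕ} {E V : Type*} [AddCommGroup E] [Module ℝ E] [AddCommGroup V] [Module ℝ V]

/-- The frame `φ(v₁, 0), …, φ(v_p, 0), φ(0, e₁), …, φ(0, e_q)`. -/
noncomputable def stableFrame (φ : (E × EuclideanSpace ℝ (Fin q)) ≃ₗ[ℝ] V) (v : Fin p → E) :
    Fin (p + q) → V :=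
  Fin.append (fun j => φ (v j, 0)) (fun j => φ (0, EuclideanSpace.single j 1))

theorem stableFrame_comp (φ : (E × EuclideanSpace ℝ (Fin q)) ≃ₗ[ℝ] V) (T : E →ₗ[ℝ] E)
    (v : Fin p → E) :
    stableFrame φ (T ∘ v) = ((φ : (E × EuclideanSpace ℝ (Fin q)) →ₗ[ℝ] V) ∘ₗ
      (T.prodMap LinearMap.id) ∘ₗ (φ.symm : V →ₗ[ℝ] (E × EuclideanSpace ℝ (Fin q)))) ∘
        stableFrame φ v := by
  funext i
  refine Fin.addCases (fun j => ?_) (fun j => ?_) i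
  · simp [stableFrame]
  · simp [stableFrame]

theorem exists_basis_eq_stableFrame (φ : (E × EuclideanSpace ℝ (Fin q)) ≃ₗ[ℝ] V)
    (b : Module.Basis (Fin p) ℝ E) :
    ∃ B : Module.Basis (Fin (p + q)) ℝ V, ⇑B = stableFrame φ b := by
  refine ⟨((b.prod (EuclideanSpace.basisFun (Fin q) ℝ).toBasis).map φ).reindex finSumFinEquiv,
    funext fun i => ?_⟩
  refine Fin.addCases (fun j => ?_) (fun j => ?_) i
  · simp [stableFrame]
  · simp [stableFrame]

theorem isOrientationPredicate_stableFrame {N : ℕ} (hN : N = p + q)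
    (φ : (E × EuclideanSpace ℝ (Fin q)) ≃ₗ[ℝ] V) (b₀ : Module.Basis (Fin p) ℝ E)
    (B : Module.Basis (Fin N) ℝ V) :
    IsOrientationPredicate fun b : Module.Basis (Fin p) ℝ E =>
      0 < B.det fun i => stableFrame φ b (finCongr hN i) := by
  subst hN
  have : Module.Free ℝ E := Module.Free.of_basis b₀
  have : Module.Finite ℝ E := Module.Finite.of_basis b₀
  refine isOrientationPredicate_of_det b₀ B (fun v => stableFrame φ v) ?_ fun T v => ?_
  · obtain ⟨B', hB'⟩ := exists_basis_eq_stableFrame φ b₀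
    rw [← hB']
    exact (B.isUnit_det B').ne_zero
  · rw [stableFrame_comp, Module.Basis.det_comp, LinearMap.det_conj, LinearMap.det_prodMap,
      LinearMap.det_id, mul_one]

end StableFrame

section PositiveBasis

variable {n m k : ℕ} {M : Type*} [TopologicalSpace M]
  [ChartedSpace (EuclideanSpace ℝ (Fin (2 * n))) M] [IsManifold (𝓡 (2 * n)) ∞ M]
  {ξ : M → Type*} [TopologicalSpace (TotalSpace (EuclideanSpace ℂ (Fin (n + m))) ξ)]
  [∀ x, AddCommGroup (ξ x)] [∀ x, Module ℂ (ξ x)]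

theorem StableComplexStructure.exists_fibre_basis (c : StableComplexStructure n m M ξ) (x : M) :
    Nonempty (Module.Basis (Fin (n + m)) ℂ (ξ x)) := by
  let φ : (EuclideanSpace ℝ (Fin (2 * n)) × EuclideanSpace ℝ (Fin (2 * m))) ≃ₗ[ℝ] ξ x := c.iso x
  have : FiniteDimensional ℝ (ξ x) := Module.Finite.equiv φ
  have : FiniteDimensional ℂ (ξ x) := Module.Finite.of_restrictScalars_finite ℝ ℂ (ξ x)
  have h : Module.finrank ℝ (ξ x) = 2 * (n + m) := by
    rw [← φ.finrank_eq, Module.finrank_prod, finrank_euclideanSpace_fin,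
      finrank_euclideanSpace_fin, Nat.mul_add]
  rw [finrank_real_of_complex] at h
  exact ⟨Module.finBasisOfFinrankEq ℂ (ξ x) (by omega)⟩

theorem StableComplexStructure.isOrientationPredicate_isPositiveBasis
    (c : StableComplexStructure n m M ξ) (x : M) :
    IsOrientationPredicate (c.IsPositiveBasis x) := by
  obtain ⟨e⟩ := c.exists_fibre_basis x
  have h := isOrientationPredicate_stableFrame (Nat.mul_add 2 n m) (c.iso x)
    (EuclideanSpace.basisFun (Fin (2 * n)) ℝ).toBasis (realBasisOfComplex e)
  convert h using 2 with b
  exact isComplexPositive_iff e _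

end PositiveBasis

/-! ### The fibre over an isolated fixed point -/

namespace EquivariantStableComplexStructure

variable {n m k : ℕ} {M : Type*} [TopologicalSpace M]
  [ChartedSpace (EuclideanSpace ℝ (Fin (2 * n))) M] [IsManifold (𝓡 (2 * n)) ∞ M]
  [MulAction (Torus k) M]
  {ξ : M → Type*} [TopologicalSpace (TotalSpace (EuclideanSpace ℂ (Fin (n + m))) ξ)]
  [∀ x, AddCommGroup (ξ x)] [∀ x, Module ℂ (ξ x)]

/-- The fibre isomorphism of `c` over `p`, with the tangent space identified with the model. -/
noncomputable def fibreIso (c : EquivariantStableComplexStructure n m k M ξ) (p : M) :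
    (EuclideanSpace ℝ (Fin (2 * n)) × EuclideanSpace ℝ (Fin (2 * m))) ≃ₗ[ℝ] ξ p :=
  c.iso p

variable (c : EquivariantStableComplexStructure n m k M ξ) {p : M}
  (hp : ∀ t : Torus k, t • p = p)

theorem rep_fibreIso (t : Torus k)
    (w : EuclideanSpace ℝ (Fin (2 * n)) × EuclideanSpace ℝ (Fin (2 * m))) :
    c.rep hp t (c.fibreIso p w) = c.fibreIso p (tangentRep n p t w.1, w.2) :=
  rep_iso c hp t w

theorem mem_trivialPart_iff (v : ξ p) : v ∈ c.trivialPart hp ↔ ∀ t, c.rep hp t v = v := by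
  simp [trivialPart, sub_eq_zero]

theorem exists_fibreIso_eq_of_mem_nontrivialPart {v : ξ p} (hv : v ∈ c.nontrivialPart hp) :
    ∃ w, c.fibreIso p (w, 0) = v := by
  induction hv using Submodule.iSup_induction' with
  | mem t v hv =>
    obtain ⟨u, rfl⟩ := hv
    obtain ⟨u, rfl⟩ := (c.fibreIso p).surjective u
    refine ⟨tangentRep n p t u.1 - u.1, ?_⟩
    rw [LinearMap.sub_apply, rep_fibreIso, LinearMap.id_apply, ← map_sub]
    congr 1
    ext <;> simp
  | zero => exact ⟨0, map_zero _⟩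
  | add v₁ v₂ _ _ h₁ h₂ =>
    obtain ⟨w₁, rfl⟩ := h₁
    obtain ⟨w₂, rfl⟩ := h₂
    exact ⟨w₁ + w₂, by rw [← map_add]; simp⟩

variable [ContMDiffSMul (torusModel k) (𝓡 (2 * n)) ∞ (Torus k) M]

/-- The nontrivial part lies in the image of `τ_p ⊕ 0` and, without fixed tangent vectors, the
trivial part lies in that of `0 ⊕ ℝ^{2m}`. They span the fibre, so the first inclusion is an
equality. -/
theorem fibreIso_mem_nontrivialPart
    (hfix : ∀ w, (∀ t : Torus k, tangentRep n p t w = w) → w = 0)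
    (w : EuclideanSpace ℝ (Fin (2 * n))) : c.fibreIso p (w, 0) ∈ c.nontrivialPart hp := by
  have htop : c.fibreIso p (w, 0) ∈ c.nontrivialPart hp ⊔ c.trivialPart hp := by
    rw [(c.isCompl_nontrivialPart_trivialPart hp).sup_eq_top]
    trivial
  obtain ⟨v, hv, u, hu, hvu⟩ := Submodule.mem_sup.1 htop
  obtain ⟨w', rfl⟩ := c.exists_fibreIso_eq_of_mem_nontrivialPart hp hv
  obtain ⟨u, rfl⟩ := (c.fibreIso p).surjective u
  rw [mem_trivialPart_iff] at hu
  have hu1 : u.1 = 0 := hfix _ fun t => by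
    have := hu t
    rw [rep_fibreIso] at this
    exact congrArg Prod.fst ((c.fibreIso p).injective this)
  rw [← map_add] at hvu
  have h := congrArg Prod.fst ((c.fibreIso p).injective hvu)
  have h' : w' + u.1 = w := h
  rw [hu1, add_zero] at h'
  rw [← h']
  exact hv

/-- If the tangent representation has no fixed vectors, the stable complex structure identifies the
tangent space with the summand without trivial summands. -/
noncomputable def tangentIso (hfix : ∀ w, (∀ t : Torus k, tangentRep n p t w = w) → w = 0) :
    EuclideanSpace ℝ (Fin (2 * n)) ≃ₗ[ℝ] c.nontrivialPart hp :=
  LinearEquiv.ofBijective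
    { toFun := fun w => ⟨c.fibreIso p (w, 0), c.fibreIso_mem_nontrivialPart hp hfix w⟩
      map_add' := fun v w => Subtype.ext <| by
        change _ = c.fibreIso p (v, 0) + c.fibreIso p (w, 0)
        rw [← map_add]
        simp
      map_smul' := fun a w => Subtype.ext <| by
        change _ = a • c.fibreIso p (w, 0)
        rw [← map_smul]
        simp }
    ⟨fun v w h => congrArg Prod.fst ((c.fibreIso p).injective (congrArg Subtype.val h)),
      fun v => (c.exists_fibreIso_eq_of_mem_nontrivialPart hp v.2).imp fun _ h => Subtype.ext h⟩

variable (hfix : ∀ w, (∀ t : Torus k, tangentRep n p t w = w) → w = 0)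

theorem rep_tangentIso (t : Torus k) (w : EuclideanSpace ℝ (Fin (2 * n))) :
    c.rep hp t (c.tangentIso hp hfix w) = c.tangentIso hp hfix (tangentRep n p t w) :=
  c.rep_fibreIso hp t (w, 0)

theorem projectionOnto_iso (w : EuclideanSpace ℝ (Fin (2 * n))) :
    (c.nontrivialPart hp).projectionOnto (c.trivialPart hp)
      (c.isCompl_nontrivialPart_trivialPart hp) (c.fibreIso p (w, 0)) = c.tangentIso hp hfix w :=
  Submodule.projectionOnto_apply_of_mem_left _ (c.fibreIso_mem_nontrivialPart hp hfix w)

theorem finrank_nontrivialPart (hfix : ∀ w, (∀ t : Torus k, tangentRep n p t w = w) → w = 0) :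
    FiniteDimensional ℂ (c.nontrivialPart hp) ∧ Module.finrank ℂ (c.nontrivialPart hp) = n := by
  have : FiniteDimensional ℝ (c.nontrivialPart hp) := Module.Finite.equiv (c.tangentIso hp hfix)
  refine ⟨Module.Finite.of_restrictScalars_finite ℝ ℂ _, ?_⟩
  have h := (c.tangentIso hp hfix).finrank_eq
  rw [finrank_euclideanSpace_fin, finrank_real_of_complex] at h
  omega

/-- The weights of an equivariant stable complex structure at an isolated fixed point exist. -/
theorem exists_isWeightVector
    (hfix : ∀ w, (∀ t : Torus k, tangentRep n p t w = w) → w = 0) :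
    ∃ Λ, c.IsWeightVector hp Λ := by
  obtain ⟨_, hn⟩ := c.finrank_nontrivialPart hp hfix
  let A := c.tangentIso hp hfix
  let e := (Module.finBasisOfFinrankEq ℂ (c.nontrivialPart hp) hn).equivFun
  have hA : ∀ t w, c.rep hp t (A w) = A (tangentRep n p t w) := c.rep_tangentIso hp hfix
  have hinv : ∀ t, ∀ v ∈ c.nontrivialPart hp, c.rep hp t v ∈ c.nontrivialPart hp := by
    intro t v hv
    obtain ⟨w, hw⟩ := A.surjective ⟨v, hv⟩
    have hw' : (A w : ξ p) = v := congrArg Subtype.val hw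
    rw [← hw', hA]
    exact (A _).2
  -- The fibres carry no norm, so the representation is moved to `ℂ^n`.
  let r : Torus k → (Fin n → ℂ) →ₗ[ℂ] (Fin n → ℂ) := fun t =>
    e.toLinearMap ∘ₗ (c.rep hp t).restrict (hinv t) ∘ₗ e.symm.toLinearMap
  have hr : ∀ t w, r t (e (A w)) = e (A (tangentRep n p t w)) := by
    intro t w
    simp only [r, LinearMap.comp_apply, LinearEquiv.coe_coe, LinearEquiv.symm_apply_apply]
    exact congrArg e (Subtype.ext (hA t w))
  have hsurj : ∀ v, ∃ w, e (A w) = v := fun v =>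
    (e.surjective v).elim fun u hu => (A.surjective u).imp fun w hw => by rw [hw, hu]
  obtain ⟨b, Λ, hb⟩ := exists_weight_basis (r := r) (n := n) (by simp)
    (fun s t v => by
      obtain ⟨w, rfl⟩ := hsurj v
      rw [hr, hr, hr, tangentRep_mul hp])
    (fun v => by
      obtain ⟨w, rfl⟩ := hsurj v
      rw [hr, tangentRep_one])
    (fun v => by
      obtain ⟨w, rfl⟩ := hsurj v
      simp only [hr]
      exact (LinearMap.continuous_of_finiteDimensional
        ((e.toLinearMap.restrictScalars ℝ) ∘ₗ A.toLinearMap)).comp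
          ((continuous_tangentRep hp).clm_apply continuous_const))
  refine ⟨Λ, b.map e.symm, fun i t => ?_⟩
  have h := congrArg (fun v => (e.symm v : ξ p)) (hb i t)
  simp only [r, LinearMap.comp_apply, LinearEquiv.coe_coe, LinearEquiv.symm_apply_apply,
    map_smul] at h
  rw [Module.Basis.map_apply]
  exact h

theorem IsWeightVector.ne_zero {c : EquivariantStableComplexStructure n m k M ξ}
    {hp : ∀ t : Torus k, t • p = p} {Λ : Fin n → Fin k → ℤ} (h : c.IsWeightVector hp Λ)
    (i : Fin n) : Λ i ≠ 0 := by
  intro h0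
  obtain ⟨b, hb⟩ := h
  have h1 : (b i : ξ p) ∈ c.trivialPart hp :=
    (c.mem_trivialPart_iff hp _).2 fun t => by rw [hb, h0, torusChar_zero, one_smul]
  have h2 := Submodule.disjoint_def.1 (c.isCompl_nontrivialPart_trivialPart hp).disjoint _
    (b i).2 h1
  exact b.ne_zero i (Subtype.ext h2)

/-- A basis of weight vectors gives complex coordinates on the tangent space in which the tangent
representation is diagonal, and which compute the orientation entering the sign. -/
theorem IsWeightVector.exists_coordinates {c : EquivariantStableComplexStructure n m k M ξ}
    {hp : ∀ t : Torus k, t • p = p} {Λ : Fin n → Fin k → ℤ} (h : c.IsWeightVector hp Λ)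
    (hfix : ∀ w, (∀ t : Torus k, tangentRep n p t w = w) → w = 0) :
    ∃ Φ : EuclideanSpace ℝ (Fin (2 * n)) ≃ₗ[ℝ] (Fin n → ℂ),
      (∀ t w i, Φ (tangentRep n p t w) i = torusChar (Λ i) t * Φ w i) ∧
      ∀ v : Fin (2 * n) → EuclideanSpace ℝ (Fin (2 * n)),
        IsComplexPositive (fun i : Fin (2 * n) =>
          (c.nontrivialPart hp).projectionOnto (c.trivialPart hp)
            (c.isCompl_nontrivialPart_trivialPart hp) (c.fibreIso p (v i, 0))) ↔
          0 < (complexStdRealBasis n).det (Φ ∘ v) := by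
  obtain ⟨b, hb⟩ := h
  obtain ⟨_, hn⟩ := c.finrank_nontrivialPart hp hfix
  refine ⟨(c.tangentIso hp hfix).trans (b.equivFun.restrictScalars ℝ), fun t w i => ?_,
    fun v => ?_⟩
  · change b.equivFun (c.tangentIso hp hfix (tangentRep n p t w)) i =
      torusChar (Λ i) t * b.equivFun (c.tangentIso hp hfix w) i
    have h1 : c.tangentIso hp hfix (tangentRep n p t w) =
        b.equivFun.symm fun i => torusChar (Λ i) t * b.equivFun (c.tangentIso hp hfix w) i := by
      refine Subtype.ext ?_
      rw [← rep_tangentIso, b.equivFun_symm_apply]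
      conv_lhs => rw [← b.sum_equivFun (c.tangentIso hp hfix w)]
      simp only [AddSubmonoidClass.coe_finsetSum, Submodule.coe_smul, map_sum, map_smul, hb,
        smul_smul, mul_comm]
    rw [h1, LinearEquiv.apply_symm_apply]
  · simp only [c.projectionOnto_iso hp hfix]
    rw [← isComplexPositive_map_iff hn b.equivFun]
    exact isComplexPositive_iff (Pi.basisFun ℂ (Fin n)) _

end EquivariantStableComplexStructure

/-! ### Local constancy of the orientations -/

section LocallyConstant

variable {n m : ℕ} {M : Type*} [TopologicalSpace M]
  [ChartedSpace (EuclideanSpace ℝ (Fin (2 * n))) M] [IsManifold (𝓡 (2 * n)) ∞ M]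

/-- The basis of a tangent space given by its identification with the model space. -/
noncomputable def modelFrame (n : ℕ) {M : Type*} [TopologicalSpace M]
    [ChartedSpace (EuclideanSpace ℝ (Fin (2 * n))) M] (x : M) :
    Module.Basis (Fin (2 * n)) ℝ (TangentSpace (𝓡 (2 * n)) x) :=
  (EuclideanSpace.basisFun (Fin (2 * n)) ℝ).toBasis

/-- The local frame of the tangent bundle near `x₀` given by the standard basis of the model. It is
continuous on the base set of the preferred trivialisation at `x₀`; outside this set it has no
meaning. -/
noncomputable def tangentFrame (n : ℕ) {M : Type*} [TopologicalSpace M]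
    [ChartedSpace (EuclideanSpace ℝ (Fin (2 * n))) M] [IsManifold (𝓡 (2 * n)) ∞ M] (x₀ x : M) :
    Module.Basis (Fin (2 * n)) ℝ (TangentSpace (𝓡 (2 * n)) x) :=
  open Classical in
  if hx : x ∈ (trivializationAt (EuclideanSpace ℝ (Fin (2 * n)))
      (TangentSpace (𝓡 (2 * n)) : M → Type _) x₀).baseSet then
    (EuclideanSpace.basisFun (Fin (2 * n)) ℝ).toBasis.map
      ((trivializationAt (EuclideanSpace ℝ (Fin (2 * n)))
        (TangentSpace (𝓡 (2 * n)) : M → Type _) x₀).continuousLinearEquivAt ℝ x hx).symm.toLinearEquiv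
  else modelFrame n x

theorem continuousAt_tangentFrame (x₀ : M) (j : Fin (2 * n)) :
    ContinuousAt (fun x => (⟨x, tangentFrame n x₀ x j⟩ :
      TotalSpace (EuclideanSpace ℝ (Fin (2 * n))) (TangentSpace (𝓡 (2 * n)) : M → Type _))) x₀ := by
  let τ := trivializationAt (EuclideanSpace ℝ (Fin (2 * n)))
    (TangentSpace (𝓡 (2 * n)) : M → Type _) x₀
  have hx₀ : x₀ ∈ τ.baseSet := mem_baseSet_trivializationAt _ _ x₀
  have hev : ∀ᶠ x in 𝓝 x₀, τ.toOpenPartialHomeomorph.symm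
      (x, EuclideanSpace.basisFun (Fin (2 * n)) ℝ j) = ⟨x, tangentFrame n x₀ x j⟩ := by
    filter_upwards [τ.open_baseSet.mem_nhds hx₀] with x hx
    rw [tangentFrame, dif_pos hx, ← τ.mk_symm hx]
    congr 1
  refine ContinuousAt.congr ?_ hev
  exact (τ.toOpenPartialHomeomorph.continuousAt_symm (τ.mem_target.2 hx₀)).comp
    (f := fun x => (x, EuclideanSpace.basisFun (Fin (2 * n)) ℝ j)) (by fun_prop)

/-- Near `x₀` a continuous frame keeps its sign for the orientation defined by a stable complex
structure: in a trivialisation of the complex bundle this sign is that of a nonvanishing continuous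
determinant. -/
theorem StableComplexStructure.eventually_isPositiveBasis_iff {ξ : M → Type*}
    [TopologicalSpace (TotalSpace (EuclideanSpace ℂ (Fin (n + m))) ξ)]
    [∀ x, AddCommGroup (ξ x)] [∀ x, Module ℂ (ξ x)] [∀ x, TopologicalSpace (ξ x)]
    [FiberBundle (EuclideanSpace ℂ (Fin (n + m))) ξ]
    [VectorBundle ℂ (EuclideanSpace ℂ (Fin (n + m))) ξ]
    (c : StableComplexStructure n m M ξ) (x₀ : M) :
    ∀ᶠ x in 𝓝 x₀, (c.IsPositiveBasis x (tangentFrame n x₀ x) ↔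
      c.IsPositiveBasis x₀ (tangentFrame n x₀ x₀)) := by
  let η := trivializationAt (EuclideanSpace ℂ (Fin (n + m))) ξ x₀
  have hη₀ : x₀ ∈ η.baseSet := mem_baseSet_trivializationAt _ _ x₀
  let B := realBasisOfComplex (EuclideanSpace.basisFun (Fin (n + m)) ℂ).toBasis
  let w : ∀ x, Fin (2 * (n + m)) → ξ x := fun x i =>
    stableFrame (c.iso x) (tangentFrame n x₀ x) (finCongr (Nat.mul_add 2 n m) i)
  let f : M → Fin (2 * (n + m)) → EuclideanSpace ℂ (Fin (n + m)) := fun x i => (η ⟨x, w x i⟩).2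
  have hpos : ∀ x ∈ η.baseSet,
      (c.IsPositiveBasis x (tangentFrame n x₀ x) ↔ 0 < B.det (f x)) := by
    intro x hx
    obtain ⟨e⟩ := c.exists_fibre_basis x
    have : FiniteDimensional ℂ (ξ x) := Module.Finite.of_basis e
    have hfin : Module.finrank ℂ (ξ x) = n + m := by
      rw [Module.finrank_eq_card_basis e, Fintype.card_fin]
    have h1 := isComplexPositive_map_iff hfin (η.continuousLinearEquivAt ℂ x hx).toLinearEquiv (w x)
    refine h1.symm.trans ?_
    exact isComplexPositive_iff (EuclideanSpace.basisFun (Fin (n + m)) ℂ).toBasis (f x)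
  have hne : B.det (f x₀) ≠ 0 := by
    obtain ⟨B', hB'⟩ := exists_basis_eq_stableFrame (c.iso x₀) (tangentFrame n x₀ x₀)
    let g : ξ x₀ ≃ₗ[ℝ] EuclideanSpace ℂ (Fin (n + m)) :=
      (η.continuousLinearEquivAt ℂ x₀ hη₀).toLinearEquiv.restrictScalars ℝ
    have h1 : f x₀ = (B'.reindex (finCongr (Nat.mul_add 2 n m)).symm).map g := by
      funext i
      rw [Module.Basis.map_apply, Module.Basis.reindex_apply, hB']
      rfl
    rw [h1]
    exact (B.isUnit_det _).ne_zero
  have hsec : ∀ (v : ∀ x : M, TangentSpace (𝓡 (2 * n)) x) (u : EuclideanSpace ℝ (Fin (2 * m))),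
      ContinuousAt (fun x => (⟨x, v x⟩ : TotalSpace (EuclideanSpace ℝ (Fin (2 * n)))
        (TangentSpace (𝓡 (2 * n)) : M → Type _))) x₀ →
      ContinuousAt (fun x => (η ⟨x, c.iso x (v x, u)⟩).2) x₀ := by
    intro v u hv
    have h1 : ContinuousAt (fun x => (⟨x, (v x, u)⟩ :
        TotalSpace (EuclideanSpace ℝ (Fin (2 * n)) × EuclideanSpace ℝ (Fin (2 * m)))
          ((TangentSpace (𝓡 (2 * n)) : M → Type _) ×ᵇ
            Bundle.Trivial M (EuclideanSpace ℝ (Fin (2 * m)))))) x₀ := by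
      rw [(FiberBundle.Prod.isInducing_diag (EuclideanSpace ℝ (Fin (2 * n)))
        (TangentSpace (𝓡 (2 * n)) : M → Type _) (EuclideanSpace ℝ (Fin (2 * m)))
        (Bundle.Trivial M (EuclideanSpace ℝ (Fin (2 * m))))).continuousAt_iff]
      refine hv.prodMk ?_
      exact ((Bundle.Trivial.homeomorphProd M
        (EuclideanSpace ℝ (Fin (2 * m)))).symm.continuous.comp
          (continuous_id.prodMk (continuous_const (y := u)))).continuousAt
    have h2 : ContinuousAt (fun x => (⟨x, c.iso x (v x, u)⟩ :
        TotalSpace (EuclideanSpace ℂ (Fin (n + m))) ξ)) x₀ :=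
      c.continuous_iso.continuousAt.comp h1
    have h3 : ContinuousAt η (⟨x₀, c.iso x₀ (v x₀, u)⟩ :
        TotalSpace (EuclideanSpace ℂ (Fin (n + m))) ξ) :=
      η.continuousAt (η.mem_source.2 hη₀)
    exact (ContinuousAt.comp (g := η) (f := fun x => ⟨x, c.iso x (v x, u)⟩) (x := x₀) h3 h2).snd
  have hzero : ContinuousAt (fun x => (⟨x, 0⟩ : TotalSpace (EuclideanSpace ℝ (Fin (2 * n)))
      (TangentSpace (𝓡 (2 * n)) : M → Type _))) x₀ :=
    (Bundle.contMDiff_zeroSection ℝ (n := 0) (IB := 𝓡 (2 * n)) (F := EuclideanSpace ℝ (Fin (2 * n)))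
      (TangentSpace (𝓡 (2 * n)) : M → Type _)).continuous.continuousAt
  have hf : ContinuousAt f x₀ := by
    refine continuousAt_pi.2 fun i => ?_
    change ContinuousAt (fun x => (η ⟨x, stableFrame (c.iso x) (tangentFrame n x₀ x)
      (finCongr (Nat.mul_add 2 n m) i)⟩).2) x₀
    generalize finCongr (Nat.mul_add 2 n m) i = i'
    refine Fin.addCases (fun j => ?_) (fun j => ?_) i'
    · simp only [stableFrame, Fin.append_left]
      exact hsec _ 0 (continuousAt_tangentFrame x₀ j)
    · simp only [stableFrame, Fin.append_right]
      exact hsec _ _ hzero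
  have hdet : ContinuousAt (fun x => B.det (f x)) x₀ := by
    simp only [Module.Basis.det_apply]
    refine ContinuousAt.comp (g := Matrix.det) (continuous_id.matrix_det).continuousAt ?_
    refine continuousAt_pi.2 fun i => continuousAt_pi.2 fun j => ?_
    exact (LinearMap.continuous_of_finiteDimensional (B.coord i)).continuousAt.comp
      ((continuous_apply j).continuousAt.comp hf)
  have hsign : ∀ᶠ y in 𝓝 (B.det (f x₀)), (0 < y ↔ 0 < B.det (f x₀)) := by
    rcases hne.lt_or_gt with h | h
    · filter_upwards [gt_mem_nhds h] with y hy
      exact iff_of_false hy.not_gt h.not_gt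
    · filter_upwards [lt_mem_nhds h] with y hy
      exact iff_of_true hy h
  filter_upwards [η.open_baseSet.mem_nhds hη₀, hdet.eventually hsign] with x hx hx'
  rw [hpos x hx, hpos x₀ hη₀, hx']

end LocallyConstant

section TwoStructures

variable {n k m₁ m₂ : ℕ} {M : Type*} [TopologicalSpace M]
  [ChartedSpace (EuclideanSpace ℝ (Fin (2 * n))) M] [IsManifold (𝓡 (2 * n)) ∞ M]
  {ξ₁ : M → Type*} [TopologicalSpace (TotalSpace (EuclideanSpace ℂ (Fin (n + m₁))) ξ₁)]
  [∀ x, AddCommGroup (ξ₁ x)] [∀ x, Module ℂ (ξ₁ x)]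
  {ξ₂ : M → Type*} [TopologicalSpace (TotalSpace (EuclideanSpace ℂ (Fin (n + m₂))) ξ₂)]
  [∀ x, AddCommGroup (ξ₂ x)] [∀ x, Module ℂ (ξ₂ x)]

/-- The set of points at which the two orientations agree is open and closed. -/
theorem StableComplexStructure.sameOrientation_or_oppositeOrientation
    [∀ x, TopologicalSpace (ξ₁ x)] [FiberBundle (EuclideanSpace ℂ (Fin (n + m₁))) ξ₁]
    [VectorBundle ℂ (EuclideanSpace ℂ (Fin (n + m₁))) ξ₁]
    [∀ x, TopologicalSpace (ξ₂ x)] [FiberBundle (EuclideanSpace ℂ (Fin (n + m₂))) ξ₂]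
    [VectorBundle ℂ (EuclideanSpace ℂ (Fin (n + m₂))) ξ₂] [PreconnectedSpace M]
    (c₁ : StableComplexStructure n m₁ M ξ₁) (c₂ : StableComplexStructure n m₂ M ξ₂) :
    c₁.SameOrientation c₂ ∨ c₁.OppositeOrientation c₂ := by
  let S : M → Prop := fun x => ∀ b, c₂.IsPositiveBasis x b ↔ c₁.IsPositiveBasis x b
  have hS : ∀ x b, (c₂.IsPositiveBasis x b ↔ c₁.IsPositiveBasis x b) ↔ S x := fun x b =>
    ⟨fun h => (c₂.isOrientationPredicate_isPositiveBasis x).iff_of_iff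
      (c₁.isOrientationPredicate_isPositiveBasis x) h, fun h => h b⟩
  have hloc : ∀ x₀, ∀ᶠ x in 𝓝 x₀, (S x ↔ S x₀) := by
    intro x₀
    filter_upwards [c₁.eventually_isPositiveBasis_iff x₀, c₂.eventually_isPositiveBasis_iff x₀]
      with x h₁ h₂
    rw [← hS x (tangentFrame n x₀ x), ← hS x₀ (tangentFrame n x₀ x₀), h₁, h₂]
  have hclopen : IsClopen {x | S x} := by
    refine ⟨isOpen_compl_iff.1 (isOpen_iff_mem_nhds.2 fun x₀ h => ?_),
      isOpen_iff_mem_nhds.2 fun x₀ h => ?_⟩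
    · filter_upwards [hloc x₀] with x hx hx'
      exact h (hx.1 hx')
    · filter_upwards [hloc x₀] with x hx
      exact hx.2 h
  rcases isClopen_iff.1 hclopen with h | h
  · refine Or.inr fun x b => ?_
    have hx : ¬ S x := fun hx => by
      have : x ∈ {x | S x} := hx
      rwa [h] at this
    exact (c₂.isOrientationPredicate_isPositiveBasis x).iff_not_of_not_forall_iff
      (c₁.isOrientationPredicate_isPositiveBasis x) hx b
  · refine Or.inl fun x b => ?_
    have hx : x ∈ {x | S x} := h ▸ Set.mem_univ x
    exact hx b

/-! ### The signs at a fixed point -/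

namespace EquivariantStableComplexStructure

variable [MulAction (Torus k) M] [ContMDiffSMul (torusModel k) (𝓡 (2 * n)) ∞ (Torus k) M] {p : M}

theorem isOrientationPredicate_coordinates
    (Φ : EuclideanSpace ℝ (Fin (2 * n)) ≃ₗ[ℝ] (Fin n → ℂ)) :
    IsOrientationPredicate fun b : Module.Basis (Fin (2 * n)) ℝ (EuclideanSpace ℝ (Fin (2 * n))) =>
      0 < (complexStdRealBasis n).det (Φ ∘ b) := by
  refine isOrientationPredicate_of_det (EuclideanSpace.basisFun (Fin (2 * n)) ℝ).toBasis
    (complexStdRealBasis n) (fun v => Φ ∘ v) ?_ fun T v => ?_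
  · have h := (complexStdRealBasis n).isUnit_det
      ((EuclideanSpace.basisFun (Fin (2 * n)) ℝ).toBasis.map Φ)
    rw [Module.Basis.coe_map] at h
    exact h.ne_zero
  · have h : Φ ∘ T ∘ v = ((Φ : EuclideanSpace ℝ (Fin (2 * n)) →ₗ[ℝ] (Fin n → ℂ)) ∘ₗ T ∘ₗ
        (Φ.symm : (Fin n → ℂ) →ₗ[ℝ] EuclideanSpace ℝ (Fin (2 * n)))) ∘ (Φ ∘ v) := by
      funext i
      simp
    rw [h, Module.Basis.det_comp, LinearMap.det_conj]

/-- The orientations of `τ_p` defined by `c₁` and `c₂` differ by `ε`, those of the coordinates `ℂ^n`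
by the product of the `a i`, and the sign compares the two. -/
theorem sign_eq_mul_prod_mul_sign (c₁ : EquivariantStableComplexStructure n m₁ k M ξ₁)
    (c₂ : EquivariantStableComplexStructure n m₂ k M ξ₂) (hp : ∀ t : Torus k, t • p = p)
    (hfix : ∀ w, (∀ t : Torus k, tangentRep n p t w = w) → w = 0) {ε : ℤˣ}
    (hε : c₁.SameOrientation c₂.toStableComplexStructure ∧ ε = 1 ∨
      c₁.OppositeOrientation c₂.toStableComplexStructure ∧ ε = -1)
    {Λ₁ Λ₂ : Fin n → Fin k → ℤ} (hΛ₁ : c₁.IsWeightVector hp Λ₁) (hΛ₂ : c₂.IsWeightVector hp Λ₂)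
    (a : Fin n → ℤˣ) (ha : ∀ i, Λ₂ i = (a i : ℤ) • Λ₁ i) :
    c₂.sign hp = ε * (∏ i, a i) * c₁.sign hp := by
  obtain ⟨Φ₁, h₁, hQ₁⟩ := hΛ₁.exists_coordinates hfix
  obtain ⟨Φ₂, h₂, hQ₂⟩ := hΛ₂.exists_coordinates hfix
  let P₁ := c₁.IsPositiveBasis p
  let P₂ := c₂.IsPositiveBasis p
  let Q₁ : Module.Basis (Fin (2 * n)) ℝ (TangentSpace (𝓡 (2 * n)) p) → Prop := fun b =>
    0 < (complexStdRealBasis n).det (Φ₁ ∘ b)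
  let Q₂ : Module.Basis (Fin (2 * n)) ℝ (TangentSpace (𝓡 (2 * n)) p) → Prop := fun b =>
    0 < (complexStdRealBasis n).det (Φ₂ ∘ b)
  have hP₁ : IsOrientationPredicate P₁ := c₁.isOrientationPredicate_isPositiveBasis p
  have hQ₁' : IsOrientationPredicate Q₁ := isOrientationPredicate_coordinates Φ₁
  let b₀ : Module.Basis (Fin (2 * n)) ℝ (TangentSpace (𝓡 (2 * n)) p) :=
    modelFrame n p
  classical
  have hs₁ : c₁.sign hp = if ∀ b, P₁ b ↔ Q₁ b then 1 else -1 :=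
    if_congr (forall_congr' fun b => iff_congr Iff.rfl (hQ₁ b)) rfl rfl
  have hs₂ : c₂.sign hp = if ∀ b, P₂ b ↔ Q₂ b then 1 else -1 :=
    if_congr (forall_congr' fun b => iff_congr Iff.rfl (hQ₂ b)) rfl rfl
  have hQ : (∏ i, a i = 1 ∧ ∀ b, Q₂ b ↔ Q₁ b) ∨ (∏ i, a i = -1 ∧ ∀ b, Q₂ b ↔ ¬ Q₁ b) :=
    coordinates_positive_iff_or_iff_not (ρ := fun t w => tangentRep n p t w)
      Φ₁ Φ₂ h₁ h₂ hΛ₁.ne_zero a ha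
  rw [hs₁, hs₂]
  have hP : (ε = 1 ∧ ∀ b, P₂ b ↔ P₁ b) ∨ (ε = -1 ∧ ∀ b, P₂ b ↔ ¬ P₁ b) :=
    hε.imp (fun h => ⟨h.2, h.1 p⟩) (fun h => ⟨h.2, h.1 p⟩)
  have hdich : (∀ b, P₁ b ↔ Q₁ b) ∨ ∀ b, P₁ b ↔ ¬ Q₁ b :=
    or_iff_not_imp_left.2 (hP₁.iff_not_of_not_forall_iff hQ₁')
  clear_value P₁ P₂ Q₁ Q₂ b₀
  have : Nonempty (Module.Basis (Fin (2 * n)) ℝ (TangentSpace (𝓡 (2 * n)) p)) := ⟨b₀⟩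
  rcases hP with ⟨rfl, hP⟩ | ⟨rfl, hP⟩ <;> rcases hQ with ⟨ha, hQ⟩ | ⟨ha, hQ⟩ <;>
    rcases hdich with h | h <;> simp [hP, hQ, ha, h, iff_not_self, not_iff_self]

end EquivariantStableComplexStructure

end TwoStructures

theorem mainTheorem2 {n k m₁ m₂ : ℕ} {M : Type*} [TopologicalSpace M]
    [ChartedSpace (EuclideanSpace ℝ (Fin (2 * n))) M] [IsManifold (𝓡 (2 * n)) ∞ M]
    -- a smooth action of the torus on the manifold
    [MulAction (Torus k) M] [ContMDiffSMul (torusModel k) (𝓡 (2 * n)) ∞ (Torus k) M]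
    -- two complex vector bundles
    {ξ₁ : M → Type*} [TopologicalSpace (TotalSpace (EuclideanSpace ℂ (Fin (n + m₁))) ξ₁)]
    [∀ x, AddCommGroup (ξ₁ x)] [∀ x, Module ℂ (ξ₁ x)] [∀ x, TopologicalSpace (ξ₁ x)]
    [FiberBundle (EuclideanSpace ℂ (Fin (n + m₁))) ξ₁]
    [VectorBundle ℂ (EuclideanSpace ℂ (Fin (n + m₁))) ξ₁]
    {ξ₂ : M → Type*} [TopologicalSpace (TotalSpace (EuclideanSpace ℂ (Fin (n + m₂))) ξ₂)]
    [∀ x, AddCommGroup (ξ₂ x)] [∀ x, Module ℂ (ξ₂ x)] [∀ x, TopologicalSpace (ξ₂ x)]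
    [FiberBundle (EuclideanSpace ℂ (Fin (n + m₂))) ξ₂]
    [VectorBundle ℂ (EuclideanSpace ℂ (Fin (n + m₂))) ξ₂]
    -- two equivariant stable complex structures
    (c₁ : EquivariantStableComplexStructure n m₁ k M ξ₁)
    (c₂ : EquivariantStableComplexStructure n m₂ k M ξ₂)
    -- the fixed points are isolated
    (hiso : ∀ p : M, (∀ t : Torus k, t • p = p) →
      ∀ᶠ q in 𝓝[≠] p, ¬ ∀ t : Torus k, t • q = q) :
    -- the weights exist and, suitably numbered, differ by signs
    (∀ (p : M) (hp : ∀ t : Torus k, t • p = p),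
      (∃ Λ₁, c₁.IsWeightVector hp Λ₁) ∧ (∃ Λ₂, c₂.IsWeightVector hp Λ₂) ∧
      ∀ Λ₁ Λ₂ : Fin n → Fin k → ℤ, c₁.IsWeightVector hp Λ₁ → c₂.IsWeightVector hp Λ₂ →
        ∃ (σ : Equiv.Perm (Fin n)) (a : Fin n → ℤˣ), ∀ i, Λ₂ (σ i) = (a i : ℤ) • Λ₁ i) ∧
    -- the relation between the signs
    (∀ ε : ℤˣ,
      (c₁.SameOrientation c₂.toStableComplexStructure ∧ ε = 1 ∨
        c₁.OppositeOrientation c₂.toStableComplexStructure ∧ ε = -1) →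
      ∀ (p : M) (hp : ∀ t : Torus k, t • p = p) (Λ₁ Λ₂ : Fin n → Fin k → ℤ),
        c₁.IsWeightVector hp Λ₁ → c₂.IsWeightVector hp Λ₂ →
        ∀ a : Fin n → ℤˣ, (∀ i, Λ₂ i = (a i : ℤ) • Λ₁ i) →
          c₂.sign hp = ε * (∏ i, a i) * c₁.sign hp) ∧
    -- on a connected manifold one of the two cases for the orientations occurs
    (ConnectedSpace M →
      c₁.SameOrientation c₂.toStableComplexStructure ∨
        c₁.OppositeOrientation c₂.toStableComplexStructure) := by
  have hfix : ∀ p : M, (∀ t : Torus k, t • p = p) → ∀ w : EuclideanSpace ℝ (Fin (2 * n)),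
      (∀ t : Torus k, EquivariantStableComplexStructure.tangentRep n p t w = w) → w = 0 :=
    fun p hp w hw => eq_zero_of_tangentRep_fixed hp (hiso p hp) hw
  refine ⟨fun p hp => ⟨c₁.exists_isWeightVector hp (hfix p hp),
    c₂.exists_isWeightVector hp (hfix p hp), fun Λ₁ Λ₂ hΛ₁ hΛ₂ => ?_⟩, ?_, fun _ =>
    c₁.sameOrientation_or_oppositeOrientation c₂.toStableComplexStructure⟩
  · obtain ⟨Φ₁, h₁, -⟩ := hΛ₁.exists_coordinates (hfix p hp)
    obtain ⟨Φ₂, h₂, -⟩ := hΛ₂.exists_coordinates (hfix p hp)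
    exact exists_perm_sign_weights
      (ρ := fun t w => EquivariantStableComplexStructure.tangentRep n p t w)
      Φ₁ Φ₂ h₁ h₂ hΛ₁.ne_zero hΛ₂.ne_zero
  · intro ε hε p hp Λ₁ Λ₂ hΛ₁ hΛ₂ a ha
    exact c₁.sign_eq_mul_prod_mul_sign c₂ hp (hfix p hp) hε hΛ₁ hΛ₂ a ha
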